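/- Let $M$ be a smooth manifold. Let $\Omega(M)$ be its algebra of differential forms, with de Rham differential $d$. Let $\Omega_{[2]}(M)$ be the $\mathbb Z^2$-graded algebra of differential gorms on $M$: over a domain with coordinates $x^i$ it is the graded-commutative algebra freely generated by the smooth functions, the odd elements $d_1x^i$, $d_2x^i$ (bidegrees $(1,0)$, $(0,1)$) and the even elements $d_1d_2x^i$ (bidegree $(1,1)$), with the coordinate changes $$d_a\tilde x^i=\frac{\partial\tilde x^i}{\partial x^j}d_ax^j,\qquad d_1d_2\tilde x^i=\frac{\partial^2\tilde x^i}{\partial x^j\partial x^k}d_1x^j\,d_2x^k+\frac{\partial\tilde x^i}{\partial x^j}d_1d_2x^j ;$$ a gorm on $M$ is a finite sum of globally defined bihomogeneous ones. In coordinates put $\xi_a^i=d_ax^i$, $y^i=d_1d_2x^i$, $\epsilon_{12}=-\epsilon_{21}=1$, $\epsilon_{11}=\epsilon_{22}=0$, and consider on $\Omega_{[2]}(M)$ the (globally well defined) derivations $$d_a=\xi_a^i\partial_{x^i}+\epsilon_{ab}\,y^i\partial_{\xi_b^i},\qquad R_1=\xi_1^i\partial_{y^i},\qquad E_1^1=\xi_1^i\partial_{\xi_1^i}+y^i\partial_{y^i}.$$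 1. One has $d^2=0$ and $d_1^2=d_2^2=0$. For $a=1,2$ the algebra embedding $\Omega(M)\to\Omega_{[2]}(M)$ given by $f\mapsto f$, $dx^i\mapsto d_ax^i$ (which sends $k$-forms to gorms of bidegree $(k,0)$ if $a=1$, and $(0,k)$ if $a=2$) commutes with the differentials $d$ and $d_a$ and induces an isomorphism from the de Rham cohomology of $M$ to the cohomology of $(\Omega_{[2]}(M),d_a)$. This isomorphism is natural: it commutes with the pullbacks by any smooth map $M\to N$ of smooth manifolds. 2. One has $R_1^2=0$, and the algebra projection $\Omega_{[2]}(M)\to\Omega(M)$ given by $d_1\mapsto 0$, $d_2\mapsto d$ (that is, $f\mapsto f$, $d_1x^i\mapsto0$, $d_2x^i\mapsto dx^i$, $d_1d_2x^i\mapsto0$) is a quasi-isomorphism from $\Omega_{[2]}(M)$ with differential $R_1$ to $\Omega(M)$ with zero differential. Moreover $[R_1,d_2]=R_1d_2+d_2R_1=-E_1^1$. -/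

import Mathlib

open scoped TensorProduct Manifold ContDiff
open TopologicalSpace

noncomputable section

namespace Gorm

/-! ### Superfunctions -/

/-- The graded commutative algebra `C[ξ_o : o ∈ O]` freely generated by a commutative algebra `C` of
even functions and finitely many odd generators `ξ_o`. -/
abbrev SF (C : Type) [CommRing C] [Algebra ℝ C] (O : Type) : Type :=
  C ⊗[ℝ] ExteriorAlgebra ℝ (O → ℝ)


/-! Shortcuts for instance search. -/

section Instances
variable {C : Type} [CommRing C] [Algebra ℝ C] {O : Type}
instance : Ring (SF C O) := inferInstance
instance : Semiring (SF C O) := inferInstance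
instance : NonAssocSemiring (SF C O) := inferInstance
instance : NonUnitalSemiring (SF C O) := inferInstance
instance : NonUnitalNonAssocSemiring (SF C O) := inferInstance
instance : NonUnitalNonAssocRing (SF C O) := inferInstance
instance : Mul (SF C O) := inferInstance
instance : AddCommGroup (SF C O) := inferInstance
instance : AddCommMonoid (SF C O) := inferInstance
instance : AddGroup (SF C O) := inferInstance
instance : AddMonoid (SF C O) := inferInstance
instance : Algebra ℝ (SF C O) := inferInstance
instance : Module ℝ (SF C O) := inferInstance
end Instances

section Superfunctions

variable {C : Type} [CommRing C] [Algebra ℝ C] {O : Type}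
variable {C' : Type} [CommRing C'] [Algebra ℝ C'] {O' : Type}

/-- Even functions as superfunctions. -/
def ev : C →ₐ[ℝ] SF C O := Algebra.TensorProduct.includeLeft

/-- The odd generator `ξ_o`. -/
def od [DecidableEq O] (o : O) : SF C O := 1 ⊗ₜ ExteriorAlgebra.ι ℝ (Pi.single o 1)

theorem sf_induction [Fintype O] [DecidableEq O] {P : SF C O → Prop}
    (h_ev : ∀ c, P (ev c)) (h_od : ∀ o, P (od o))
    (h_add : ∀ a b, P a → P b → P (a + b)) (h_mul : ∀ a b, P a → P b → P (a * b))
    (a : SF C O) : P a := by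
  have key : ∀ x : ExteriorAlgebra ℝ (O → ℝ), P (1 ⊗ₜ x) := by
    intro x
    induction x using ExteriorAlgebra.induction with
    | algebraMap r =>
      have := h_ev (algebraMap ℝ C r)
      rwa [ev, Algebra.TensorProduct.includeLeft_apply, ← Algebra.TensorProduct.algebraMap_apply,
        Algebra.TensorProduct.algebraMap_apply'] at this
    | ι v =>
      have hv : v = ∑ o, v o • (Pi.single o 1 : O → ℝ) := by
        ext i; simp [Finset.sum_apply, Pi.single_apply]
      rw [hv, map_sum, TensorProduct.tmul_sum]
      refine Finset.sum_induction _ P h_add ?_ ?_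
      · simpa using h_ev 0
      · intro o _
        have := h_mul _ _ (h_ev (algebraMap ℝ C (v o))) (h_od o)
        rw [AlgHom.commutes, ← Algebra.smul_def] at this
        simpa [od] using this
    | mul a b ha hb =>
      have := h_mul _ _ ha hb
      simpa using this
    | add a b ha hb => rw [TensorProduct.tmul_add]; exact h_add _ _ ha hb
  induction a using TensorProduct.induction_on with
  | zero => simpa using h_ev 0
  | tmul c x =>
    have := h_mul _ _ (h_ev c) (key x)
    simpa [ev] using this
  | add a b ha hb => exact h_add _ _ ha hb

theorem ev_comm (c : C) (a : SF C O) : ev c * a = a * ev c := by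
  induction a using TensorProduct.induction_on with
  | zero => simp
  | tmul c x => simp [ev, mul_comm]
  | add a b ha hb => rw [mul_add, add_mul, ha, hb]

theorem od_anticomm [DecidableEq O] (o p : O) : (od o : SF C O) * od p = - (od p * od o) := by
  have := ExteriorAlgebra.ι_add_mul_swap (R := ℝ) (Pi.single o 1 : O → ℝ) (Pi.single p 1)
  simp only [od, Algebra.TensorProduct.tmul_mul_tmul, mul_one]
  rw [eq_neg_of_add_eq_zero_left this, TensorProduct.tmul_neg]

/-- Even functions are central. -/
def evc : C →ₐ[ℝ] Subalgebra.center ℝ (SF C O) :=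
  ev.codRestrict _ fun c => Subalgebra.mem_center_iff.mpr fun a => (ev_comm c a).symm

theorem od_mul_od_mem_center [Fintype O] [DecidableEq O] (o p : O) :
    (od o * od p : SF C O) ∈ Subalgebra.center ℝ (SF C O) := by
  rw [Subalgebra.mem_center_iff]
  intro a
  induction a using sf_induction with
  | h_ev c => exact ev_comm _ _
  | h_od q =>
    rw [← mul_assoc, od_anticomm q o, neg_mul, mul_assoc, od_anticomm q p, mul_neg, neg_neg,
      mul_assoc]
  | h_add a b ha hb => rw [mul_add, add_mul, ha, hb]
  | h_mul a b ha hb => rw [mul_assoc, hb, ← mul_assoc, ha, mul_assoc]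

/-- The odd superfunction `∑ c_o ξ_o`. -/
def lin [Fintype O] [DecidableEq O] : (O → C) →ₗ[ℝ] SF C O :=
  ∑ o, (LinearMap.mulRight ℝ (od o)) ∘ₗ ev.toLinearMap ∘ₗ LinearMap.proj o

theorem lin_apply [Fintype O] [DecidableEq O] (c : O → C) : lin c = ∑ o, ev (c o) * od o := by
  simp [lin, LinearMap.sum_apply]

theorem lin_mul_self [Fintype O] [DecidableEq O] (c : O → C) : lin c * lin c = 0 := by
  have h : lin c * lin c = - (lin c * lin c) := by
    conv_lhs => rw [lin_apply, Finset.sum_mul_sum, Finset.sum_comm]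
    rw [lin_apply, Finset.sum_mul_sum, ← Finset.sum_neg_distrib]
    refine Finset.sum_congr rfl fun o _ => ?_
    rw [← Finset.sum_neg_distrib]
    refine Finset.sum_congr rfl fun p _ => ?_
    rw [mul_assoc, ← mul_assoc (od p), ← ev_comm, mul_assoc, ← mul_assoc, ← map_mul, od_anticomm,
      mul_assoc (ev (c o)), ← mul_assoc (od o), ← ev_comm, mul_assoc, ← mul_assoc (ev (c o)),
      ← map_mul, mul_comm (c p), mul_neg]
  have h2 : (2 : ℝ) • (lin c * lin c : SF C O) = 0 := by
    rw [two_smul]; nth_rewrite 2 [h]; rw [add_neg_cancel]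
  exact (smul_eq_zero.mp h2).resolve_left two_ne_zero

/-- The algebra homomorphism that is `h` on even functions and sends `ξ_o` to
`∑_p v_{op} ξ_p`. -/
def lift [Fintype O] [Fintype O'] [DecidableEq O'] (h : C →ₐ[ℝ] Subalgebra.center ℝ (SF C' O'))
    (v : O → O' → C') : SF C O →ₐ[ℝ] SF C' O' :=
  Algebra.TensorProduct.lift ((Subalgebra.center ℝ (SF C' O')).val.comp h)
    (ExteriorAlgebra.lift ℝ ⟨lin ∘ₗ Fintype.linearCombination ℝ v, fun _ => lin_mul_self _⟩)
    fun x _ => ((Subalgebra.mem_center_iff.mp (h x).2) _).symm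

@[simp]
theorem lift_ev [Fintype O] [Fintype O'] [DecidableEq O']
    (h : C →ₐ[ℝ] Subalgebra.center ℝ (SF C' O')) (v : O → O' → C') (c : C) :
    lift h v (ev c) = h c := by
  rw [lift, ev, Algebra.TensorProduct.includeLeft_apply]
  erw [Algebra.TensorProduct.lift_tmul]
  simp

@[simp]
theorem lift_od [Fintype O] [DecidableEq O] [Fintype O'] [DecidableEq O']
    (h : C →ₐ[ℝ] Subalgebra.center ℝ (SF C' O')) (v : O → O' → C') (o : O) :
    lift h v (od o) = ∑ p, ev (v o p) * od p := by
  rw [← lin_apply, lift, od]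
  erw [Algebra.TensorProduct.lift_tmul]
  rw [ExteriorAlgebra.lift_ι_apply]
  simp [Fintype.linearCombination_apply_single]

/-! ### Vector fields (derivations of superfunctions) -/

/-- A derivation of the even functions, extended to superfunctions so that it kills all `ξ_o`. -/
def dEven (δ : Derivation ℝ C C) : SF C O →ₗ[ℝ] SF C O :=
  TensorProduct.map δ.toLinearMap LinearMap.id

/-- The odd derivation `∂/∂ξ_o` (killing all even functions and all `ξ_p`, `p ≠ o`). -/
def dOdd (o : O) : SF C O →ₗ[ℝ] SF C O :=
  TensorProduct.map LinearMap.id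
    (CliffordAlgebra.contractLeft (Q := (0 : QuadraticForm ℝ (O → ℝ))) (LinearMap.proj o))

/-- The parity automorphism `ξ_o ↦ -ξ_o`. -/
def par : SF C O →ₐ[ℝ] SF C O :=
  Algebra.TensorProduct.map (AlgHom.id ℝ C)
    (CliffordAlgebra.involute (Q := (0 : QuadraticForm ℝ (O → ℝ))))

@[simp] theorem par_ev (c : C) : par (ev c : SF C O) = ev c := by simp [par, ev]

@[simp] theorem par_od [DecidableEq O] (o : O) : par (od o : SF C O) = - od o := by
  have : CliffordAlgebra.involute (ExteriorAlgebra.ι ℝ (Pi.single o 1 : O → ℝ)) =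
    - ExteriorAlgebra.ι ℝ (Pi.single o 1 : O → ℝ) := CliffordAlgebra.involute_ι _
  simp [par, od, this, TensorProduct.tmul_neg]

/-- Even derivations. -/
def IsEvenDer (D : SF C O →ₗ[ℝ] SF C O) : Prop :=
  (∀ a b, D (a * b) = D a * b + a * D b) ∧ ∀ a, par (D a) = D (par a)

/-- Odd derivations. -/
def IsOddDer (D : SF C O →ₗ[ℝ] SF C O) : Prop :=
  (∀ a b, D (a * b) = D a * b + par a * D b) ∧ ∀ a, par (D a) = - D (par a)

theorem isEvenDer_dEven (δ : Derivation ℝ C C) : IsEvenDer (dEven δ : SF C O →ₗ[ℝ] SF C O) := by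
  constructor
  · intro a b
    induction a using TensorProduct.induction_on with
    | zero => simp
    | add a a' ha ha' => simp only [add_mul, map_add, ha, ha']; abel
    | tmul c x =>
      induction b using TensorProduct.induction_on with
      | zero => simp
      | add a a' ha ha' => simp only [mul_add, map_add, ha, ha']; abel
      | tmul d y =>
        simp [dEven, TensorProduct.add_tmul, mul_comm, add_comm]
  · intro a
    induction a using TensorProduct.induction_on with
    | zero => simp
    | add a a' ha ha' => simp only [map_add, ha, ha']
    | tmul c x => simp [dEven, par]

theorem contract_mul (o : O) (x y : ExteriorAlgebra ℝ (O → ℝ)) :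
    CliffordAlgebra.contractLeft (Q := (0 : QuadraticForm ℝ (O → ℝ))) (LinearMap.proj o) (x * y) =
    CliffordAlgebra.contractLeft (Q := (0 : QuadraticForm ℝ (O → ℝ))) (LinearMap.proj o) x * y +
    CliffordAlgebra.involute x *
      CliffordAlgebra.contractLeft (Q := (0 : QuadraticForm ℝ (O → ℝ))) (LinearMap.proj o) y := by
  induction x using CliffordAlgebra.left_induction with
  | algebraMap r =>
    rw [CliffordAlgebra.contractLeft_algebraMap_mul, CliffordAlgebra.contractLeft_algebraMap,
      AlgHom.commutes, zero_mul, zero_add]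
  | add x y hx hy => simp only [add_mul, map_add, hx, hy]; abel
  | ι_mul x m hx =>
    rw [mul_assoc, CliffordAlgebra.contractLeft_ι_mul, hx, CliffordAlgebra.contractLeft_ι_mul,
      map_mul, CliffordAlgebra.involute_ι]
    simp only [sub_mul, mul_add, neg_mul, smul_mul_assoc, mul_assoc]
    abel

theorem contract_involute (o : O) (x : ExteriorAlgebra ℝ (O → ℝ)) :
    CliffordAlgebra.involute
      (CliffordAlgebra.contractLeft (Q := (0 : QuadraticForm ℝ (O → ℝ))) (LinearMap.proj o) x) =
    - CliffordAlgebra.contractLeft (Q := (0 : QuadraticForm ℝ (O → ℝ))) (LinearMap.proj o)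
      (CliffordAlgebra.involute x) := by
  induction x using CliffordAlgebra.left_induction with
  | algebraMap r => simp [CliffordAlgebra.contractLeft_algebraMap]
  | add x y hx hy => simp only [map_add, hx, hy]; abel
  | ι_mul x m hx =>
    rw [CliffordAlgebra.contractLeft_ι_mul, map_mul, CliffordAlgebra.involute_ι, neg_mul,
      map_neg, neg_neg, CliffordAlgebra.contractLeft_ι_mul, map_sub, map_mul,
      CliffordAlgebra.involute_ι, hx, map_smul]
    simp

theorem isOddDer_dOdd (o : O) : IsOddDer (dOdd o : SF C O →ₗ[ℝ] SF C O) := by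
  constructor
  · intro a b
    induction a using TensorProduct.induction_on with
    | zero => simp
    | add a a' ha ha' => simp only [add_mul, map_add, ha, ha']; abel
    | tmul c x =>
      induction b using TensorProduct.induction_on with
      | zero => simp
      | add a a' ha ha' => simp only [mul_add, map_add, ha, ha']; abel
      | tmul d y =>
        have := contract_mul o x y
        simp only [dOdd, par, Algebra.TensorProduct.tmul_mul_tmul, TensorProduct.map_tmul,
          Algebra.TensorProduct.map_tmul, LinearMap.id_apply, AlgHom.id_apply]
        rw [← TensorProduct.tmul_add]
        exact congrArg _ this
  · intro a
    induction a using TensorProduct.induction_on with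
    | zero => simp
    | add a a' ha ha' => simp only [map_add, ha, ha']; abel
    | tmul c x =>
      have := contract_involute o x
      simp only [dOdd, par, TensorProduct.map_tmul,
          Algebra.TensorProduct.map_tmul, LinearMap.id_apply, AlgHom.id_apply]
      rw [← TensorProduct.tmul_neg]
      exact congrArg _ this

@[simp] theorem dEven_ev (δ : Derivation ℝ C C) (c : C) :
    dEven δ (ev c : SF C O) = ev (δ c) := by simp [dEven, ev]

@[simp] theorem dEven_od [DecidableEq O] (δ : Derivation ℝ C C) (o : O) :
    dEven δ (od o : SF C O) = 0 := by simp [dEven, od]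

@[simp] theorem dOdd_ev (o : O) (c : C) : dOdd o (ev c : SF C O) = 0 := by
  simp [dOdd, ev, CliffordAlgebra.contractLeft_one]

@[simp] theorem dOdd_od [DecidableEq O] (o p : O) :
    dOdd o (od p : SF C O) = if o = p then 1 else 0 := by
  have : CliffordAlgebra.contractLeft (Q := (0 : QuadraticForm ℝ (O → ℝ))) (LinearMap.proj o)
    (ExteriorAlgebra.ι ℝ (Pi.single p (1 : ℝ))) = algebraMap _ _ ((Pi.single p (1:ℝ) : O → ℝ) o) :=
      CliffordAlgebra.contractLeft_ι _ _ _
  simp only [dOdd, od, TensorProduct.map_tmul, LinearMap.id_apply, this]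
  split_ifs with h
  · subst h; simp [Algebra.TensorProduct.one_def]
  · simp [h]

theorem od_mul [Fintype O] [DecidableEq O] (o : O) (a : SF C O) : od o * a = par a * od o := by
  induction a using sf_induction with
  | h_ev c => simp [ev_comm]
  | h_od q => simp [od_anticomm o q]
  | h_add a b ha hb => rw [mul_add, ha, hb, map_add, add_mul]
  | h_mul a b ha hb => rw [← mul_assoc, ha, mul_assoc, hb, map_mul, mul_assoc]

theorem IsEvenDer.add {D D' : SF C O →ₗ[ℝ] SF C O} (h : IsEvenDer D) (h' : IsEvenDer D') :
    IsEvenDer (D + D') :=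
  ⟨fun a b => by simp only [LinearMap.add_apply, h.1, h'.1, add_mul, mul_add]; abel,
   fun a => by simp only [LinearMap.add_apply, map_add, h.2, h'.2]⟩

theorem IsOddDer.add {D D' : SF C O →ₗ[ℝ] SF C O} (h : IsOddDer D) (h' : IsOddDer D') :
    IsOddDer (D + D') :=
  ⟨fun a b => by simp only [LinearMap.add_apply, h.1, h'.1, add_mul, mul_add]; abel,
   fun a => by simp only [LinearMap.add_apply, map_add, h.2, h'.2]; abel⟩

theorem IsEvenDer.sum {κ : Type} (s : Finset κ) {D : κ → SF C O →ₗ[ℝ] SF C O}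
    (h : ∀ i, IsEvenDer (D i)) : IsEvenDer (∑ i ∈ s, D i) :=
  Finset.sum_induction _ IsEvenDer (fun _ _ => IsEvenDer.add) ⟨by simp, by simp⟩ fun i _ => h i

theorem IsOddDer.sum {κ : Type} (s : Finset κ) {D : κ → SF C O →ₗ[ℝ] SF C O}
    (h : ∀ i, IsOddDer (D i)) : IsOddDer (∑ i ∈ s, D i) :=
  Finset.sum_induction _ IsOddDer (fun _ _ => IsOddDer.add) ⟨by simp, by simp⟩ fun i _ => h i

theorem IsEvenDer.smul {D : SF C O →ₗ[ℝ] SF C O} (h : IsEvenDer D) (r : ℝ) :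
    IsEvenDer (r • D) :=
  ⟨fun a b => by simp [h.1], fun a => by simp [h.2]⟩

theorem IsOddDer.smul {D : SF C O →ₗ[ℝ] SF C O} (h : IsOddDer D) (r : ℝ) :
    IsOddDer (r • D) :=
  ⟨fun a b => by simp [h.1], fun a => by simp [h.2]⟩

theorem IsEvenDer.ev_mul {D : SF C O →ₗ[ℝ] SF C O} (h : IsEvenDer D) (c : C) :
    IsEvenDer (LinearMap.mulLeft ℝ (ev c) ∘ₗ D) :=
  ⟨fun a b => by simp [h.1, mul_add, ← mul_assoc, ev_comm c a], fun a => by simp [h.2]⟩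

theorem IsOddDer.ev_mul {D : SF C O →ₗ[ℝ] SF C O} (h : IsOddDer D) (c : C) :
    IsOddDer (LinearMap.mulLeft ℝ (ev c) ∘ₗ D) :=
  ⟨fun a b => by simp [h.1, mul_add, ← mul_assoc, ev_comm c (par a)], fun a => by simp [h.2]⟩

theorem IsEvenDer.od_mul [Fintype O] [DecidableEq O] {D : SF C O →ₗ[ℝ] SF C O} (h : IsEvenDer D)
    (o : O) : IsOddDer (LinearMap.mulLeft ℝ (od o) ∘ₗ D) :=
  ⟨fun a b => by simp [h.1, mul_add, ← mul_assoc, Gorm.od_mul o a], fun a => by simp [h.2]⟩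

theorem par_par [Fintype O] [DecidableEq O] (a : SF C O) : par (par a) = a := by
  induction a using sf_induction with
  | h_ev c => simp
  | h_od q => simp
  | h_add a b ha hb => simp [ha, hb]
  | h_mul a b ha hb => simp [ha, hb]

theorem IsOddDer.od_mul [Fintype O] [DecidableEq O] {D : SF C O →ₗ[ℝ] SF C O} (h : IsOddDer D)
    (o : O) : IsEvenDer (LinearMap.mulLeft ℝ (od o) ∘ₗ D) :=
  ⟨fun a b => by
    simp [h.1, mul_add, ← mul_assoc, Gorm.od_mul o (par a), par_par], fun a => by simp [h.2]⟩

theorem IsOddDer.bracket [Fintype O] [DecidableEq O] {D D' : SF C O →ₗ[ℝ] SF C O} (h : IsOddDer D) (h' : IsOddDer D') :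
    IsEvenDer (D ∘ₗ D' + D' ∘ₗ D) := by
  constructor
  · intro a b
    have hp : ∀ a, D (par a) = - par (D a) := fun a => by rw [h.2, neg_neg]
    have hp' : ∀ a, D' (par a) = - par (D' a) := fun a => by rw [h'.2, neg_neg]
    simp only [LinearMap.add_apply, LinearMap.comp_apply, h.1, h'.1, map_add, hp, hp', add_mul,
      mul_add, neg_mul, par_par]
    abel
  · intro a
    simp [h.2, h'.2]

theorem IsEvenDer.comm {E D : SF C O →ₗ[ℝ] SF C O} (hE : IsEvenDer E) (hD : IsOddDer D) :
    IsOddDer (E ∘ₗ D - D ∘ₗ E) := by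
  constructor
  · intro a b
    simp only [LinearMap.sub_apply, LinearMap.comp_apply, hE.1, hD.1, map_add, hE.2,
      mul_sub, sub_mul]
    abel
  · intro a
    simp only [LinearMap.sub_apply, LinearMap.comp_apply, map_sub, hE.2, hD.2, map_neg]
    abel

theorem IsEvenDer.map_one {D : SF C O →ₗ[ℝ] SF C O} (h : IsEvenDer D) : D 1 = 0 := by
  have := h.1 1 1
  simpa using this

theorem IsOddDer.map_one {D : SF C O →ₗ[ℝ] SF C O} (h : IsOddDer D) : D 1 = 0 := by
  have := h.1 1 1
  simpa using this

end Superfunctions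

/-! ### Smooth functions of real coordinates -/

/-- Open subsets of `ℝᵐ`. -/
abbrev Dom (m : ℕ) : Type := Opens (EuclideanSpace ℝ (Fin m))

/-- The algebra `C^∞(U)`. -/
abbrev Sm {m : ℕ} (U : Dom m) : Type := C^∞⟮𝓡 m, U; 𝓘(ℝ, ℝ), ℝ⟯


/-! Shortcuts for instance search. -/

section Instances
variable {m : ℕ} {U : Dom m}
instance : CommRing (Sm U) := inferInstance
instance : Ring (Sm U) := inferInstance
instance : CommSemiring (Sm U) := inferInstance
instance : Semiring (Sm U) := inferInstance
instance : NonAssocSemiring (Sm U) := inferInstance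
instance : NonUnitalNonAssocSemiring (Sm U) := inferInstance
instance : Mul (Sm U) := inferInstance
instance : AddCommGroup (Sm U) := inferInstance
instance : AddCommMonoid (Sm U) := inferInstance
instance : AddMonoid (Sm U) := inferInstance
instance : Algebra ℝ (Sm U) := inferInstance
instance : Module ℝ (Sm U) := inferInstance
end Instances

section Smooth

variable {m k : ℕ} {U : Dom m} {W : Dom k}

/-- Extension by zero, used only to speak about derivatives at points of `U`. -/
def ext0 (f : U → ℝ) : EuclideanSpace ℝ (Fin m) → ℝ := Function.extend Subtype.val f 0

theorem ext0_apply (f : U → ℝ) (x : U) : ext0 f x = f x :=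
  Subtype.val_injective.extend_apply _ _ _

theorem contDiffAt_ext0 (f : Sm U) (x : U) : ContDiffAt ℝ ∞ (ext0 f) (x : EuclideanSpace ℝ (Fin m)) := by
  rw [← contMDiffAt_iff_contDiffAt, ← contMDiffAt_subtype_iff]
  have : (fun y : U => ext0 f y) = f := funext fun y => ext0_apply _ _
  rw [this]
  exact f.contMDiff x

theorem ext0_eventuallyEq (f : U → ℝ) (g : EuclideanSpace ℝ (Fin m) → ℝ) (h : ∀ y : U, g y = f y)
    (x : U) : ext0 f =ᶠ[nhds (x : EuclideanSpace ℝ (Fin m))] g := by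
  filter_upwards [U.2.mem_nhds x.2] with y hy
  rw [h ⟨y, hy⟩]; exact ext0_apply f ⟨y, hy⟩

/-- Restriction to `U` of a function that is smooth at the points of `U`. -/
def Sm.mk' (g : EuclideanSpace ℝ (Fin m) → ℝ)
    (hg : ∀ x : U, ContDiffAt ℝ ∞ g (x : EuclideanSpace ℝ (Fin m))) : Sm U :=
  ⟨fun x => g x, fun x => contMDiffAt_subtype_iff.mpr (contMDiffAt_iff_contDiffAt.mpr (hg x))⟩

/-- The partial derivative `∂f/∂x^i` of a smooth function on `U`. -/
def pdFun (i : Fin m) (f : Sm U) : Sm U :=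
  Sm.mk' (fun x => fderiv ℝ (ext0 f) x (EuclideanSpace.single i 1)) fun x =>
    ((contDiffAt_ext0 f x).fderiv_right (m := ∞) (by simp)).clm_apply contDiffAt_const

theorem pdFun_apply (i : Fin m) (f : Sm U) (x : U) :
    pdFun i f x = fderiv ℝ (ext0 f) x (EuclideanSpace.single i 1) := rfl

theorem diffAt_ext0 (f : Sm U) (x : U) :
    DifferentiableAt ℝ (ext0 f) (x : EuclideanSpace ℝ (Fin m)) :=
  (contDiffAt_ext0 f x).differentiableAt (by simp)

/-- The partial derivative `∂/∂x^i` as a derivation of `C^∞(U)`. -/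
def pd (i : Fin m) : Derivation ℝ (Sm U) (Sm U) :=
  Derivation.mk'
    { toFun := pdFun i
      map_add' := fun f g => by
        ext x
        have h := ext0_eventuallyEq (f + g : Sm U) (ext0 f + ext0 g)
          (fun y => by simp [ext0_apply]) x
        simp only [ContMDiffMap.coe_add, Pi.add_apply, pdFun_apply]
        rw [← ContMDiffMap.coe_add, h.fderiv_eq, fderiv_add (diffAt_ext0 f x) (diffAt_ext0 g x)]
        rfl
      map_smul' := fun r f => by
        ext x
        have h := ext0_eventuallyEq (r • f : Sm U) (r • ext0 f)
          (fun y => by simp [ext0_apply]) x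
        simp only [ContMDiffMap.coe_smul, Pi.smul_apply, pdFun_apply, RingHom.id_apply]
        rw [← ContMDiffMap.coe_smul, h.fderiv_eq, fderiv_const_smul (diffAt_ext0 f x)]
        rfl }
    fun f g => by
      ext x
      have h := ext0_eventuallyEq (f * g : Sm U) (ext0 f * ext0 g)
        (fun y => by simp [ext0_apply]) x
      simp only [LinearMap.coe_mk, AddHom.coe_mk, smul_eq_mul, ContMDiffMap.coe_add,
        ContMDiffMap.coe_mul, Pi.add_apply, Pi.mul_apply, pdFun_apply]
      rw [← ContMDiffMap.coe_mul, h.fderiv_eq, fderiv_mul (diffAt_ext0 f x) (diffAt_ext0 g x)]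
      simp [ext0_apply]

theorem pd_apply (i : Fin m) (f : Sm U) (x : U) :
    pd i f x = fderiv ℝ (ext0 f) x (EuclideanSpace.single i 1) := rfl

theorem pd_pd (i j : Fin m) (f : Sm U) : pd i (pd j f) = pd j (pd i f) := by
  ext x
  have key : ∀ i j : Fin m, pd i (pd j f) x = fderiv ℝ (fderiv ℝ (ext0 f)) x
      (EuclideanSpace.single i 1) (EuclideanSpace.single j 1) := by
    intro i j
    have h := ext0_eventuallyEq (pd j f)
      (fun y => fderiv ℝ (ext0 f) y (EuclideanSpace.single j 1)) (fun y => rfl) x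
    rw [pd_apply, h.fderiv_eq]
    have hd : DifferentiableAt ℝ (fderiv ℝ (ext0 f)) (x : EuclideanSpace ℝ (Fin m)) :=
      ((contDiffAt_ext0 f x).fderiv_right (m := 1) (by norm_cast)).differentiableAt (by simp)
    rw [fderiv_clm_apply hd (differentiableAt_const _)]
    simp
  rw [key, key]
  have hs : IsSymmSndFDerivAt ℝ (ext0 f) (x : EuclideanSpace ℝ (Fin m)) :=
    (contDiffAt_ext0 f x).isSymmSndFDerivAt (by
      rw [minSmoothness_of_isRCLikeNormedField]
      exact WithTop.coe_le_coe.mpr (le_top : (2 : ℕ∞) ≤ ⊤))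
  exact hs.eq _ _

/-- Smooth maps `U → W`. -/
abbrev SmMap (U : Dom m) (W : Dom k) : Type := C^∞⟮𝓡 m, U; 𝓡 k, W⟯

/-- The `i`-th coordinate function of a smooth map `U → W ⊆ ℝᵏ`. -/
def coord (φ : SmMap U W) (i : Fin k) : Sm U :=
  ⟨fun x => (φ x : EuclideanSpace ℝ (Fin k)) i, by
    have h1 : ContMDiff (𝓡 m) (𝓡 k) ∞ fun x => (φ x : EuclideanSpace ℝ (Fin k)) :=
      contMDiff_subtype_val.comp φ.contMDiff
    exact ((EuclideanSpace.proj i : EuclideanSpace ℝ (Fin k) →L[ℝ] ℝ).contMDiff).comp h1⟩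

/-- Pullback of smooth functions, `f ↦ f ∘ φ`. -/
def pullSm (φ : SmMap U W) : Sm W →ₐ[ℝ] Sm U where
  toFun f := f.comp φ
  map_one' := rfl
  map_mul' _ _ := rfl
  map_zero' := rfl
  map_add' _ _ := rfl
  commutes' _ := rfl

theorem pd_pullSm (φ : SmMap U W) (f : Sm W) (j : Fin m) :
    pd j (pullSm φ f) = ∑ i, pullSm φ (pd i f) * pd j (coord φ i) := by
  ext x
  have hsum : ∀ (s : Finset (Fin k)) (F : Fin k → Sm U), (∑ i ∈ s, F i) x = ∑ i ∈ s, F i x :=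
    fun s F => map_sum (ContMDiffMap.evalRingHom x) F s
  let Φ : EuclideanSpace ℝ (Fin m) → EuclideanSpace ℝ (Fin k) :=
    fun y => WithLp.toLp 2 fun i => ext0 (coord φ i) y
  have hΦ : ∀ y : U, Φ y = φ y := fun y => by
    ext i; simp only [Φ, ext0_apply]; rfl
  have hdΦ : HasFDerivAt Φ ((PiLp.continuousLinearEquiv 2 ℝ (fun _ : Fin k => ℝ)).symm.toContinuousLinearMap ∘L
      ContinuousLinearMap.pi fun i => fderiv ℝ (ext0 (coord φ i)) x)
      (x : EuclideanSpace ℝ (Fin m)) := by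
    refine ((PiLp.continuousLinearEquiv 2 ℝ (fun _ : Fin k => ℝ)).symm.toContinuousLinearMap.hasFDerivAt).comp
      (x : EuclideanSpace ℝ (Fin m)) (hasFDerivAt_pi.mpr fun i => (diffAt_ext0 (coord φ i) x).hasFDerivAt)
  have hf : HasFDerivAt (ext0 f) (fderiv ℝ (ext0 f) (φ x)) (Φ x) := by
    rw [hΦ]; exact (diffAt_ext0 f (φ x)).hasFDerivAt
  have h := ext0_eventuallyEq (pullSm φ f) (ext0 f ∘ Φ)
    (fun y => by rw [Function.comp_apply, hΦ, ext0_apply]; rfl) x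
  rw [pd_apply, h.fderiv_eq, (hf.comp _ hdΦ).fderiv, hsum]
  have hv : ∀ v : EuclideanSpace ℝ (Fin k), v = ∑ i, v i • EuclideanSpace.single i (1 : ℝ) := by
    intro v; ext j; simp [Finset.sum_apply, Pi.single_apply]
  rw [ContinuousLinearMap.comp_apply, hv ((_ : EuclideanSpace ℝ (Fin m) →L[ℝ] _) _), map_sum]
  refine Finset.sum_congr rfl fun i _ => ?_
  rw [map_smul, smul_eq_mul, mul_comm]
  rfl

end Smooth

/-! ### Differential forms on open subsets of `ℝᵐ` -/

section LocalForms

variable {m k : ℕ} {U : Dom m} {W : Dom k}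

/-- Differential forms on `U`: freely generated by `C^∞(U)` and the `dx^i`. -/
abbrev FormLoc (U : Dom m) : Type := SF (Sm U) (Fin m)

/-- The function `f`, as a form. -/
abbrev ffn (f : Sm U) : FormLoc U := ev f

/-- The form `dx^i`. -/
abbrev dx (i : Fin m) : FormLoc U := od i

/-- The de Rham differential `d = dx^i ∂/∂x^i`. -/
def dF : FormLoc U →ₗ[ℝ] FormLoc U := ∑ i, LinearMap.mulLeft ℝ (dx i) ∘ₗ dEven (pd i)

/-- The degree operator `dx^i ∂/∂(dx^i)`. -/
def EF : FormLoc U →ₗ[ℝ] FormLoc U := ∑ i, LinearMap.mulLeft ℝ (dx i) ∘ₗ dOdd i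

/-- Pullback of forms: `f ↦ f ∘ φ`, `dx^i ↦ (∂φ^i/∂x^j) dx^j`. -/
def pullF (φ : SmMap U W) : FormLoc W →ₐ[ℝ] FormLoc U :=
  lift (evc.comp (pullSm φ)) fun i j => pd j (coord φ i)

theorem isOddDer_dF : IsOddDer (dF : FormLoc U →ₗ[ℝ] FormLoc U) :=
  IsOddDer.sum _ fun i => (isEvenDer_dEven _).od_mul i

theorem isEvenDer_EF : IsEvenDer (EF : FormLoc U →ₗ[ℝ] FormLoc U) :=
  IsEvenDer.sum _ fun i => (isOddDer_dOdd _).od_mul i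

end LocalForms

/-! ### Differential gorms on open subsets of `ℝᵐ` -/

section LocalGorms

variable {m k : ℕ} {U : Dom m} {W : Dom k}

/-- Even functions of the coordinates `x^i` and `y^i = d₁d₂x^i`: smooth in `x`, polynomial in `y`. -/
abbrev Coef (U : Dom m) : Type := Sm U ⊗[ℝ] MvPolynomial (Fin m) ℝ

instance : CommRing (Coef U) := inferInstance
instance : Ring (Coef U) := inferInstance
instance : CommSemiring (Coef U) := inferInstance
instance : Semiring (Coef U) := inferInstance
instance : NonAssocSemiring (Coef U) := inferInstance
instance : NonUnitalNonAssocSemiring (Coef U) := inferInstance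
instance : Mul (Coef U) := inferInstance
instance : AddCommGroup (Coef U) := inferInstance
instance : AddCommMonoid (Coef U) := inferInstance
instance : AddMonoid (Coef U) := inferInstance
instance : Algebra ℝ (Coef U) := inferInstance
instance : Module ℝ (Coef U) := inferInstance

/-- Differential gorms on `U`: the graded commutative algebra freely generated by `C^∞(U)`, the odd
elements `ξ_a^i = d_a x^i` (`a = 1, 2`) and the even elements `y^i = d₁d₂x^i`.
The values `0, 1` of `a : Fin 2` stand for the indices `1, 2`. -/
abbrev GormLoc (U : Dom m) : Type := SF (Coef U) (Fin 2 × Fin m)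

instance : Ring (GormLoc U) := inferInstance
instance : Semiring (GormLoc U) := inferInstance
instance : NonAssocSemiring (GormLoc U) := inferInstance
instance : NonUnitalSemiring (GormLoc U) := inferInstance
instance : NonUnitalNonAssocSemiring (GormLoc U) := inferInstance
instance : NonUnitalNonAssocRing (GormLoc U) := inferInstance
instance : Mul (GormLoc U) := inferInstance
instance : AddCommGroup (GormLoc U) := inferInstance
instance : AddCommMonoid (GormLoc U) := inferInstance
instance : AddGroup (GormLoc U) := inferInstance
instance : AddMonoid (GormLoc U) := inferInstance
instance : Algebra ℝ (GormLoc U) := inferInstance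
instance : Module ℝ (GormLoc U) := inferInstance


/-- The function `f`, as a gorm. -/
def fn (f : Sm U) : GormLoc U := ev (f ⊗ₜ 1)

/-- The gorm `ξ_a^i = d_a x^i`. -/
def xi (a : Fin 2) (i : Fin m) : GormLoc U := od (a, i)

/-- The gorm `y^i = d₁d₂x^i`. -/
def yy (i : Fin m) : GormLoc U := ev (1 ⊗ₜ MvPolynomial.X i)

/-- `∂/∂x^i` on even functions of `x` and `y`. -/
def coefDx (i : Fin m) : Derivation ℝ (Coef U) (Coef U) :=
  Derivation.mk' (TensorProduct.map (pd i).toLinearMap LinearMap.id) fun a b => by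
    induction a using TensorProduct.induction_on with
    | zero => simp
    | add a a' ha ha' => simp only [add_mul, map_add, ha, ha', smul_eq_mul, mul_add]; abel
    | tmul c x =>
      induction b using TensorProduct.induction_on with
      | zero => simp
      | add a a' ha ha' => simp only [mul_add, map_add, ha, ha', smul_eq_mul, add_mul]; abel
      | tmul d y => simp [TensorProduct.add_tmul, mul_comm]

/-- `∂/∂y^i` on even functions of `x` and `y`. -/
def coefDy (i : Fin m) : Derivation ℝ (Coef U) (Coef U) :=
  Derivation.mk' (TensorProduct.map LinearMap.id (MvPolynomial.pderiv i).toLinearMap) fun a b => by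
    induction a using TensorProduct.induction_on with
    | zero => simp
    | add a a' ha ha' => simp only [add_mul, map_add, ha, ha', smul_eq_mul, mul_add]; abel
    | tmul c x =>
      induction b using TensorProduct.induction_on with
      | zero => simp
      | add a a' ha ha' => simp only [mul_add, map_add, ha, ha', smul_eq_mul, add_mul]; abel
      | tmul d y => simp [TensorProduct.tmul_add, mul_comm]

/-- The vector field `∂/∂x^i`. -/
def ddx (i : Fin m) : GormLoc U →ₗ[ℝ] GormLoc U := dEven (coefDx i)

/-- The vector field `∂/∂y^i`. -/
def ddy (i : Fin m) : GormLoc U →ₗ[ℝ] GormLoc U := dEven (coefDy i)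

/-- The vector field `∂/∂ξ_a^i`. -/
def ddxi (a : Fin 2) (i : Fin m) : GormLoc U →ₗ[ℝ] GormLoc U := dOdd (a, i)

/-- `ε_{ab}`, with `ε_{12} = 1`. -/
def eps : Matrix (Fin 2) (Fin 2) ℝ := !![0, 1; -1, 0]

/-- The differentials `d_a = ξ_a^i ∂/∂x^i + ε_{ab} y^i ∂/∂ξ_b^i`. -/
def dG (a : Fin 2) : GormLoc U →ₗ[ℝ] GormLoc U :=
  ∑ i, LinearMap.mulLeft ℝ (xi a i) ∘ₗ ddx i +
    ∑ b, ∑ i, eps a b • (LinearMap.mulLeft ℝ (yy i) ∘ₗ ddxi b i)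

/-- The degrees `E_a^a = ξ_a^i ∂/∂ξ_a^i + y^i ∂/∂y^i` (no sum over `a`). -/
def EG (a : Fin 2) : GormLoc U →ₗ[ℝ] GormLoc U :=
  ∑ i, LinearMap.mulLeft ℝ (xi a i) ∘ₗ ddxi a i + ∑ i, LinearMap.mulLeft ℝ (yy i) ∘ₗ ddy i

/-- The vector fields `R_a = ξ_a^i ∂/∂y^i`. -/
def RG (a : Fin 2) : GormLoc U →ₗ[ℝ] GormLoc U := ∑ i, LinearMap.mulLeft ℝ (xi a i) ∘ₗ ddy i

/-- The pullback of `y^i`: the gorm `(∂φ^i/∂x^j) y^j + (∂²φ^i/∂x^j∂x^k) ξ_1^j ξ_2^k`. -/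
def pullY (φ : SmMap U W) (i : Fin k) : GormLoc U :=
  ∑ j, fn (pd j (coord φ i)) * yy j +
    ∑ j, ∑ l, fn (pd j (pd l (coord φ i))) * (xi 0 j * xi 1 l)

theorem ev_mem_center (c : Coef U) : (ev c : GormLoc U) ∈ Subalgebra.center ℝ (GormLoc U) :=
  (evc c).2

theorem pullY_mem_center (φ : SmMap U W) (i : Fin k) :
    pullY φ i ∈ Subalgebra.center ℝ (GormLoc U) :=
  add_mem (sum_mem fun _ _ => mul_mem (ev_mem_center _) (ev_mem_center _))
    (sum_mem fun _ _ => sum_mem fun _ _ => mul_mem (ev_mem_center _) (od_mul_od_mem_center _ _))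

/-- Pullback of gorms: `f ↦ f ∘ φ`, `ξ_a^i ↦ (∂φ^i/∂x^j) ξ_a^j`,
`y^i ↦ (∂φ^i/∂x^j) y^j + (∂²φ^i/∂x^j∂x^k) ξ_1^j ξ_2^k`. -/
def pullG (φ : SmMap U W) : GormLoc W →ₐ[ℝ] GormLoc U :=
  lift
    (Algebra.TensorProduct.productMap
      ((evc.comp Algebra.TensorProduct.includeLeft).comp (pullSm φ))
      (MvPolynomial.aeval fun i => ⟨pullY φ i, pullY_mem_center φ i⟩))
    fun p q => if p.1 = q.1 then pd q.2 (coord φ p.2) ⊗ₜ 1 else 0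

/-- The embedding of forms in gorms given by `d ↦ d_a`: `f ↦ f`, `dx^i ↦ ξ_a^i`. -/
def incl (a : Fin 2) : FormLoc U →ₐ[ℝ] GormLoc U :=
  lift (evc.comp Algebra.TensorProduct.includeLeft) fun i q => if q = (a, i) then 1 else 0

/-- The projection of gorms to forms given by `d_a ↦ d`, `d_b ↦ 0` for `b ≠ a`:
`f ↦ f`, `ξ_a^i ↦ dx^i`, `ξ_b^i ↦ 0`, `y^i ↦ 0`. -/
def proj (a : Fin 2) : GormLoc U →ₐ[ℝ] FormLoc U :=
  lift (Algebra.TensorProduct.productMap evc (MvPolynomial.aeval fun _ => 0))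
    fun p j => if p = (a, j) then 1 else 0

/-! #### Values on generators -/

theorem gorm_induction {P : GormLoc U → Prop} (h_fn : ∀ f, P (fn f)) (h_xi : ∀ a i, P (xi a i))
    (h_yy : ∀ i, P (yy i)) (h_add : ∀ a b, P a → P b → P (a + b))
    (h_mul : ∀ a b, P a → P b → P (a * b)) (a : GormLoc U) : P a := by
  induction a using sf_induction with
  | h_ev c =>
    have key : ∀ p : MvPolynomial (Fin m) ℝ, P (ev (1 ⊗ₜ p)) := by
      intro p
      induction p using MvPolynomial.induction_on with
      | C r =>
        have := h_fn (algebraMap ℝ (Sm U) r)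
        rwa [fn, ← Algebra.TensorProduct.algebraMap_apply,
          Algebra.TensorProduct.algebraMap_apply'] at this
      | add p q hp hq => rw [TensorProduct.tmul_add, map_add]; exact h_add _ _ hp hq
      | mul_X p i hp =>
        have := h_mul _ _ hp (h_yy i)
        rwa [yy, ← map_mul, Algebra.TensorProduct.tmul_mul_tmul, mul_one] at this
    induction c using TensorProduct.induction_on with
    | zero =>
      have := h_fn 0
      rwa [fn, TensorProduct.zero_tmul] at this
    | add a b ha hb => rw [map_add]; exact h_add _ _ ha hb
    | tmul f p =>
      have := h_mul _ _ (h_fn f) (key p)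
      rwa [fn, ← map_mul, Algebra.TensorProduct.tmul_mul_tmul, mul_one, one_mul] at this
  | h_od p => exact h_xi p.1 p.2
  | h_add a b ha hb => exact h_add a b ha hb
  | h_mul a b ha hb => exact h_mul a b ha hb

@[simp] theorem coefDx_apply (i : Fin m) (f : Sm U) (p : MvPolynomial (Fin m) ℝ) :
    coefDx i (f ⊗ₜ p) = pd i f ⊗ₜ p := rfl

@[simp] theorem coefDy_apply (i : Fin m) (f : Sm U) (p : MvPolynomial (Fin m) ℝ) :
    coefDy i (f ⊗ₜ p) = f ⊗ₜ MvPolynomial.pderiv i p := rfl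

@[simp] theorem par_fn (f : Sm U) : par (fn f) = fn f := par_ev _
@[simp] theorem par_yy (i : Fin m) : par (yy i : GormLoc U) = yy i := par_ev _
@[simp] theorem par_xi (a : Fin 2) (i : Fin m) : par (xi a i : GormLoc U) = - xi a i := par_od _

theorem dG_fn (a : Fin 2) (f : Sm U) : dG a (fn f) = ∑ i, fn (pd i f) * xi a i := by
  simp [dG, fn, ddx, ddxi, LinearMap.sum_apply, ev_comm]

theorem dG_xi (a b : Fin 2) (i : Fin m) : dG a (xi b i : GormLoc U) = eps a b • yy i := by
  fin_cases b <;> simp [dG, xi, ddx, ddxi, LinearMap.sum_apply, Prod.ext_iff]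

theorem dG_yy (a : Fin 2) (i : Fin m) : dG a (yy i : GormLoc U) = 0 := by
  simp [dG, yy, ddx, ddxi, LinearMap.sum_apply]

theorem RG_fn (a : Fin 2) (f : Sm U) : RG a (fn f) = 0 := by
  simp [RG, fn, ddy, LinearMap.sum_apply]

theorem RG_xi (a b : Fin 2) (i : Fin m) : RG a (xi b i : GormLoc U) = 0 := by
  simp [RG, xi, ddy, LinearMap.sum_apply]

theorem RG_yy (a : Fin 2) (i : Fin m) : RG a (yy i : GormLoc U) = xi a i := by
  have : ∀ j, (1 : Sm U) ⊗ₜ[ℝ] (Pi.single i (1 : MvPolynomial (Fin m) ℝ) : Fin m → _) j =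
    if j = i then 1 else 0 := by
    intro j; by_cases h : j = i
    · subst h; simp [Algebra.TensorProduct.one_def]
    · simp [h]
  simp [RG, yy, ddy, LinearMap.sum_apply, MvPolynomial.pderiv_X, Pi.single_comm, this, apply_ite]

theorem EG_fn (a : Fin 2) (f : Sm U) : EG a (fn f) = 0 := by
  simp [EG, fn, ddy, ddxi, LinearMap.sum_apply]

theorem EG_xi (a b : Fin 2) (i : Fin m) :
    EG a (xi b i : GormLoc U) = if a = b then xi b i else 0 := by
  simp [EG, xi, ddxi, ddy, LinearMap.sum_apply, Prod.ext_iff, ite_and]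
  split_ifs with h <;> simp [h]

theorem EG_yy (a : Fin 2) (i : Fin m) : EG a (yy i : GormLoc U) = yy i := by
  have : ∀ j, (1 : Sm U) ⊗ₜ[ℝ] (Pi.single i (1 : MvPolynomial (Fin m) ℝ) : Fin m → _) j =
    if j = i then 1 else 0 := by
    intro j; by_cases h : j = i
    · subst h; simp [Algebra.TensorProduct.one_def]
    · simp [h]
  simp [EG, yy, ddy, ddxi, LinearMap.sum_apply, MvPolynomial.pderiv_X, Pi.single_comm, this,
    apply_ite]

theorem isOddDer_dG (a : Fin 2) : IsOddDer (dG a : GormLoc U →ₗ[ℝ] GormLoc U) :=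
  (IsOddDer.sum _ fun _ => (isEvenDer_dEven _).od_mul _).add
    (IsOddDer.sum _ fun _ => IsOddDer.sum _ fun _ => ((isOddDer_dOdd _).ev_mul _).smul _)

theorem isOddDer_RG (a : Fin 2) : IsOddDer (RG a : GormLoc U →ₗ[ℝ] GormLoc U) :=
  IsOddDer.sum _ fun _ => (isEvenDer_dEven _).od_mul _

theorem isEvenDer_EG (a : Fin 2) : IsEvenDer (EG a : GormLoc U →ₗ[ℝ] GormLoc U) :=
  (IsEvenDer.sum _ fun _ => (isOddDer_dOdd _).od_mul _).add
    (IsEvenDer.sum _ fun _ => (isEvenDer_dEven _).ev_mul _)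

@[simp] theorem pullG_fn (φ : SmMap U W) (f : Sm W) : pullG φ (fn f) = fn (pullSm φ f) := by
  rw [pullG, fn, lift_ev]; simp [evc, fn]

@[simp] theorem pullG_yy (φ : SmMap U W) (i : Fin k) : pullG φ (yy i) = pullY φ i := by
  have h1 : evc ((1 : Sm U) ⊗ₜ[ℝ] (1 : MvPolynomial (Fin m) ℝ)) =
    (1 : Subalgebra.center ℝ (GormLoc U)) := map_one _
  rw [pullG, yy, lift_ev]; simp [h1]

@[simp] theorem pullG_xi (φ : SmMap U W) (a : Fin 2) (i : Fin k) :
    pullG φ (xi a i) = ∑ j, fn (pd j (coord φ i)) * xi a j := by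
  rw [pullG, xi, lift_od, Fintype.sum_prod_type]
  simp only [apply_ite, map_zero, ite_mul, zero_mul]
  rw [Finset.sum_eq_single a (by intro b _ hb; simp [Ne.symm hb]) (by simp)]
  simp [fn, xi]

@[simp] theorem incl_ffn (a : Fin 2) (f : Sm U) : incl a (ffn f) = fn f := by
  rw [incl, lift_ev]; rfl

@[simp] theorem incl_dx (a : Fin 2) (i : Fin m) : incl a (dx i : FormLoc U) = xi a i := by
  rw [incl, lift_od]; simp [apply_ite, xi]

@[simp] theorem proj_fn (a : Fin 2) (f : Sm U) : proj a (fn f) = ffn f := by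
  rw [proj, fn, lift_ev]; simp [evc]

@[simp] theorem proj_yy (a : Fin 2) (i : Fin m) : proj a (yy i : GormLoc U) = 0 := by
  rw [proj, yy, lift_ev]; simp

@[simp] theorem proj_xi (a b : Fin 2) (i : Fin m) :
    proj a (xi b i : GormLoc U) = if b = a then dx i else 0 := by
  rw [proj, xi, lift_od]
  split_ifs with h
  · subst h; simp [apply_ite]
  · simp [h]

@[simp] theorem pullF_ffn (φ : SmMap U W) (f : Sm W) : pullF φ (ffn f) = ffn (pullSm φ f) := by
  rw [pullF, lift_ev]; rfl

@[simp] theorem pullF_dx (φ : SmMap U W) (i : Fin k) :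
    pullF φ (dx i) = ∑ j, ffn (pd j (coord φ i)) * dx j := by
  rw [pullF, lift_od]

theorem dF_ffn (f : Sm U) : dF (ffn f) = ∑ i, ffn (pd i f) * dx i := by
  simp [dF, LinearMap.sum_apply, ev_comm]

theorem dF_dx (i : Fin m) : dF (dx i : FormLoc U) = 0 := by
  simp [dF, LinearMap.sum_apply]

theorem EF_ffn (f : Sm U) : EF (ffn f) = 0 := by
  simp [EF, LinearMap.sum_apply]

theorem EF_dx (i : Fin m) : EF (dx i : FormLoc U) = dx i := by
  simp [EF, LinearMap.sum_apply]


/-! #### Homomorphisms intertwining derivations -/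

section Twist

variable {C' : Type} [CommRing C'] [Algebra ℝ C'] {O' : Type} {C : Type} [CommRing C]
  [Algebra ℝ C] {O : Type}

theorem twist_odd_mul {h : SF C O →ₐ[ℝ] SF C' O'} (hp : ∀ a, h (par a) = par (h a))
    {D : SF C O →ₗ[ℝ] SF C O} {D' : SF C' O' →ₗ[ℝ] SF C' O'} (hD : IsOddDer D) (hD' : IsOddDer D')
    (a b : SF C O) (ha : h (D a) = D' (h a)) (hb : h (D b) = D' (h b)) :
    h (D (a * b)) = D' (h (a * b)) := by
  rw [hD.1, map_add, map_mul, map_mul, map_mul, hD'.1, ha, hb, hp]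

theorem twist_even_mul {h : SF C O →ₐ[ℝ] SF C' O'}
    {D : SF C O →ₗ[ℝ] SF C O} {D' : SF C' O' →ₗ[ℝ] SF C' O'} (hD : IsEvenDer D)
    (hD' : IsEvenDer D')
    (a b : SF C O) (ha : h (D a) = D' (h a)) (hb : h (D b) = D' (h b)) :
    h (D (a * b)) = D' (h (a * b)) := by
  rw [hD.1, map_add, map_mul, map_mul, map_mul, hD'.1, ha, hb]

theorem gorm_twist_odd {h : GormLoc W →ₐ[ℝ] SF C' O'} (hp : ∀ a, h (par a) = par (h a))
    {D : GormLoc W →ₗ[ℝ] GormLoc W} {D' : SF C' O' →ₗ[ℝ] SF C' O'} (hD : IsOddDer D)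
    (hD' : IsOddDer D') (h_fn : ∀ f, h (D (fn f)) = D' (h (fn f)))
    (h_xi : ∀ a i, h (D (xi a i)) = D' (h (xi a i))) (h_yy : ∀ i, h (D (yy i)) = D' (h (yy i)))
    (w : GormLoc W) : h (D w) = D' (h w) := by
  induction w using gorm_induction with
  | h_fn f => exact h_fn f
  | h_xi a i => exact h_xi a i
  | h_yy i => exact h_yy i
  | h_add a b ha hb => simp only [map_add, ha, hb]
  | h_mul a b ha hb => exact twist_odd_mul hp hD hD' a b ha hb

theorem gorm_twist_even {h : GormLoc W →ₐ[ℝ] SF C' O'}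
    {D : GormLoc W →ₗ[ℝ] GormLoc W} {D' : SF C' O' →ₗ[ℝ] SF C' O'} (hD : IsEvenDer D)
    (hD' : IsEvenDer D') (h_fn : ∀ f, h (D (fn f)) = D' (h (fn f)))
    (h_xi : ∀ a i, h (D (xi a i)) = D' (h (xi a i))) (h_yy : ∀ i, h (D (yy i)) = D' (h (yy i)))
    (w : GormLoc W) : h (D w) = D' (h w) := by
  induction w using gorm_induction with
  | h_fn f => exact h_fn f
  | h_xi a i => exact h_xi a i
  | h_yy i => exact h_yy i
  | h_add a b ha hb => simp only [map_add, ha, hb]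
  | h_mul a b ha hb => exact twist_even_mul hD hD' a b ha hb

theorem form_twist_odd {h : FormLoc W →ₐ[ℝ] SF C' O'} (hp : ∀ a, h (par a) = par (h a))
    {D : FormLoc W →ₗ[ℝ] FormLoc W} {D' : SF C' O' →ₗ[ℝ] SF C' O'} (hD : IsOddDer D)
    (hD' : IsOddDer D') (h_fn : ∀ f, h (D (ffn f)) = D' (h (ffn f)))
    (h_dx : ∀ i, h (D (dx i)) = D' (h (dx i)))
    (w : FormLoc W) : h (D w) = D' (h w) := by
  induction w using sf_induction with
  | h_ev f => exact h_fn f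
  | h_od i => exact h_dx i
  | h_add a b ha hb => simp only [map_add, ha, hb]
  | h_mul a b ha hb => exact twist_odd_mul hp hD hD' a b ha hb

theorem form_twist_even {h : FormLoc W →ₐ[ℝ] SF C' O'}
    {D : FormLoc W →ₗ[ℝ] FormLoc W} {D' : SF C' O' →ₗ[ℝ] SF C' O'} (hD : IsEvenDer D)
    (hD' : IsEvenDer D') (h_fn : ∀ f, h (D (ffn f)) = D' (h (ffn f)))
    (h_dx : ∀ i, h (D (dx i)) = D' (h (dx i)))
    (w : FormLoc W) : h (D w) = D' (h w) := by
  induction w using sf_induction with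
  | h_ev f => exact h_fn f
  | h_od i => exact h_dx i
  | h_add a b ha hb => simp only [map_add, ha, hb]
  | h_mul a b ha hb => exact twist_even_mul hD hD' a b ha hb

theorem gorm_hom_ext {A : Type} [Ring A] [Algebra ℝ A] {h h' : GormLoc W →ₐ[ℝ] A}
    (h_fn : ∀ f, h (fn f) = h' (fn f)) (h_xi : ∀ a i, h (xi a i) = h' (xi a i))
    (h_yy : ∀ i, h (yy i) = h' (yy i)) : h = h' := by
  apply AlgHom.ext; intro w
  induction w using gorm_induction with
  | h_fn f => exact h_fn f
  | h_xi a i => exact h_xi a i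
  | h_yy i => exact h_yy i
  | h_add a b ha hb => simp only [map_add, ha, hb]
  | h_mul a b ha hb => simp only [map_mul, ha, hb]

theorem form_hom_ext {A : Type} [Ring A] [Algebra ℝ A] {h h' : FormLoc W →ₐ[ℝ] A}
    (h_fn : ∀ f, h (ffn f) = h' (ffn f)) (h_dx : ∀ i, h (dx i) = h' (dx i)) : h = h' := by
  apply AlgHom.ext; intro w
  induction w using sf_induction with
  | h_ev f => exact h_fn f
  | h_od i => exact h_dx i
  | h_add a b ha hb => simp only [map_add, ha, hb]
  | h_mul a b ha hb => simp only [map_mul, ha, hb]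

end Twist

theorem isEvenDer_zero : IsEvenDer (0 : GormLoc U →ₗ[ℝ] GormLoc U) := ⟨by simp, by simp⟩

theorem isOddDer_zero : IsOddDer (0 : GormLoc U →ₗ[ℝ] GormLoc U) := ⟨by simp, by simp⟩

theorem pullG_par (φ : SmMap U W) (w : GormLoc W) : pullG φ (par w) = par (pullG φ w) := by
  have : (pullG φ).comp par = (par : GormLoc U →ₐ[ℝ] GormLoc U).comp (pullG φ) := by
    refine gorm_hom_ext (fun f => ?_) (fun a i => ?_) (fun i => ?_)
    · simp
    · simp
    · simp [pullY]
  exact DFunLike.congr_fun this w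

theorem incl_par (a : Fin 2) (w : FormLoc U) : incl a (par w) = par (incl a w) := by
  have : (incl a).comp par = (par : GormLoc U →ₐ[ℝ] GormLoc U).comp (incl a) := by
    refine form_hom_ext (fun f => ?_) (fun i => ?_) <;> simp
  exact DFunLike.congr_fun this w

theorem pullF_par (φ : SmMap U W) (w : FormLoc W) : pullF φ (par w) = par (pullF φ w) := by
  have : (pullF φ).comp par = (par : FormLoc U →ₐ[ℝ] FormLoc U).comp (pullF φ) := by
    refine form_hom_ext (fun f => ?_) (fun i => ?_) <;> simp
  exact DFunLike.congr_fun this w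

/-! #### Compatibilities -/

theorem dG_dG_fn (a b : Fin 2) (f : Sm U) : dG a (dG b (fn f)) =
    eps a b • ∑ j, fn (pd j f) * yy j + ∑ j, ∑ l, fn (pd j (pd l f)) * (xi a j * xi b l) := by
  rw [dG_fn, map_sum, Finset.smul_sum, Finset.sum_comm, ← Finset.sum_add_distrib]
  refine Finset.sum_congr rfl fun i _ => ?_
  rw [(isOddDer_dG a).1, dG_fn, dG_xi, par_fn, add_comm, Finset.sum_mul, mul_smul_comm]
  simp only [mul_assoc]

theorem dG_anticomm (a b : Fin 2) (w : GormLoc U) : dG a (dG b w) = - dG b (dG a w) := by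
  rw [← add_eq_zero_iff_eq_neg]
  refine gorm_twist_even (h := AlgHom.id ℝ (GormLoc U)) ((isOddDer_dG a).bracket (isOddDer_dG b))
    isEvenDer_zero (fun f => ?_) (fun c i => ?_) (fun i => ?_) w
  · have h1 : ∑ j, ∑ l, fn (pd j (pd l f)) * (xi a j * xi b l) =
        - ∑ j, ∑ l, fn (pd j (pd l f)) * (xi b j * xi a l) := by
      rw [Finset.sum_comm, ← Finset.sum_neg_distrib]
      refine Finset.sum_congr rfl fun j _ => ?_
      rw [← Finset.sum_neg_distrib]
      refine Finset.sum_congr rfl fun l _ => ?_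
      rw [pd_pd, ← mul_neg]
      congr 1
      exact od_anticomm _ _
    have h2 : eps a b = - eps b a := by fin_cases a <;> fin_cases b <;> simp [eps]
    simp only [AlgHom.id_apply, LinearMap.add_apply, LinearMap.comp_apply, dG_dG_fn, h1, h2,
      LinearMap.zero_apply, neg_smul]
    abel
  · simp [dG_xi, dG_yy]
  · simp [dG_yy]

theorem dG_dG (a : Fin 2) (w : GormLoc U) : dG a (dG a w) = 0 := by
  have h := dG_anticomm a a w
  have h2 : (2 : ℝ) • dG a (dG a w) = 0 := by
    rw [two_smul]; nth_rewrite 2 [h]; rw [add_neg_cancel]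
  exact (smul_eq_zero.mp h2).resolve_left two_ne_zero

theorem pullY_eq (φ : SmMap U W) (i : Fin k) : pullY φ i = dG 0 (dG 1 (fn (coord φ i))) := by
  rw [dG_dG_fn]; simp [pullY, eps]

theorem pullG_dG (a : Fin 2) (φ : SmMap U W) (w : GormLoc W) :
    pullG φ (dG a w) = dG a (pullG φ w) := by
  have hxi : ∀ b i, pullG φ (xi b i) = dG b (fn (coord φ i)) := fun b i => by
    rw [pullG_xi, dG_fn]
  refine gorm_twist_odd (pullG_par φ) (isOddDer_dG a) (isOddDer_dG a) (fun f => ?_)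
    (fun b i => ?_) (fun i => ?_) w
  · rw [dG_fn, pullG_fn, dG_fn, map_sum]
    simp only [map_mul, pullG_fn, pullG_xi, pd_pullSm, Finset.mul_sum]
    rw [Finset.sum_comm]
    refine Finset.sum_congr rfl fun j _ => ?_
    simp only [fn, TensorProduct.sum_tmul, map_sum, Finset.sum_mul]
    refine Finset.sum_congr rfl fun i _ => ?_
    rw [← mul_assoc, ← map_mul, Algebra.TensorProduct.tmul_mul_tmul, mul_one]
  · rw [dG_xi, map_smul, pullG_yy, hxi, pullY_eq]
    fin_cases a <;> fin_cases b
    · simp [eps, dG_dG]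
    · simp [eps]
    · simp [eps, dG_anticomm 1 0]
    · simp [eps, dG_dG]
  · rw [dG_yy, map_zero, pullG_yy, pullY_eq]
    fin_cases a
    · simp [dG_dG]
    · simp [dG_anticomm 1 0, dG_dG]

theorem pullG_RG (a : Fin 2) (φ : SmMap U W) (w : GormLoc W) :
    pullG φ (RG a w) = RG a (pullG φ w) := by
  refine gorm_twist_odd (pullG_par φ) (isOddDer_RG a) (isOddDer_RG a) (fun f => ?_)
    (fun b i => ?_) (fun i => ?_) w
  · simp [RG_fn]
  · simp [RG_xi, (isOddDer_RG a).1, RG_fn]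
  · simp [RG_xi, (isOddDer_RG a).1, RG_fn, RG_yy, pullY]

theorem pullG_EG (a : Fin 2) (φ : SmMap U W) (w : GormLoc W) :
    pullG φ (EG a w) = EG a (pullG φ w) := by
  refine gorm_twist_even (isEvenDer_EG a) (isEvenDer_EG a) (fun f => ?_)
    (fun b i => ?_) (fun i => ?_) w
  · simp [EG_fn]
  · simp only [EG_xi, pullG_xi, map_sum, (isEvenDer_EG a).1, EG_fn, zero_mul, zero_add]
    split_ifs <;> simp
  · fin_cases a <;>
    simp [EG_xi, (isEvenDer_EG _).1, EG_fn, EG_yy, pullY]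

theorem dF_dF (w : FormLoc U) : dF (dF w) = 0 := by
  have h2 : (2 : ℝ) • dF (dF w) = 0 := by
    rw [two_smul]
    refine form_twist_even (h := AlgHom.id ℝ (FormLoc U)) (isOddDer_dF.bracket isOddDer_dF)
      (D' := 0) ⟨by simp, by simp⟩ (fun f => ?_) (fun i => ?_) w
    · have h1 : dF (dF (ffn f)) = ∑ j, ∑ l, ffn (pd j (pd l f)) * (dx j * dx l) := by
        rw [dF_ffn, map_sum, Finset.sum_comm]
        refine Finset.sum_congr rfl fun i _ => ?_
        rw [isOddDer_dF.1, dF_ffn, dF_dx, par_ev, mul_zero, add_zero, Finset.sum_mul]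
        simp only [mul_assoc]
      have h3 : ∑ j, ∑ l, ffn (pd j (pd l f)) * (dx j * dx l : FormLoc U) =
          - ∑ j, ∑ l, ffn (pd j (pd l f)) * (dx j * dx l) := by
        conv_lhs => rw [Finset.sum_comm]
        rw [← Finset.sum_neg_distrib]
        refine Finset.sum_congr rfl fun j _ => ?_
        rw [← Finset.sum_neg_distrib]
        refine Finset.sum_congr rfl fun l _ => ?_
        rw [pd_pd, ← mul_neg]
        congr 1
        exact od_anticomm _ _
      simp only [AlgHom.id_apply, LinearMap.add_apply, LinearMap.comp_apply, LinearMap.zero_apply]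
      rw [h1]; nth_rewrite 2 [h3]; rw [add_neg_cancel]
    · simp [dF_dx]
  exact (smul_eq_zero.mp h2).resolve_left two_ne_zero

theorem pullF_dF (φ : SmMap U W) (w : FormLoc W) : pullF φ (dF w) = dF (pullF φ w) := by
  refine form_twist_odd (pullF_par φ) isOddDer_dF isOddDer_dF (fun f => ?_) (fun i => ?_) w
  · rw [dF_ffn, pullF_ffn, dF_ffn, map_sum]
    simp only [map_mul, pullF_ffn, pullF_dx, pd_pullSm, Finset.mul_sum]
    rw [Finset.sum_comm]
    refine Finset.sum_congr rfl fun j _ => ?_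
    simp only [map_sum, Finset.sum_mul]
    refine Finset.sum_congr rfl fun i _ => ?_
    rw [← mul_assoc, ← map_mul]
  · rw [dF_dx, map_zero, pullF_dx, ← dF_ffn, dF_dF]

theorem pullF_EF (φ : SmMap U W) (w : FormLoc W) : pullF φ (EF w) = EF (pullF φ w) := by
  refine form_twist_even isEvenDer_EF isEvenDer_EF (fun f => ?_) (fun i => ?_) w
  · simp [EF_ffn]
  · simp [EF_ffn, EF_dx, isEvenDer_EF.1]

theorem incl_dF (a : Fin 2) (w : FormLoc U) : incl a (dF w) = dG a (incl a w) := by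
  refine form_twist_odd (incl_par a) isOddDer_dF (isOddDer_dG a) (fun f => ?_) (fun i => ?_) w
  · simp [dF_ffn, dG_fn]
  · fin_cases a <;> simp [dF_dx, dG_xi, eps]

theorem incl_pullF (a : Fin 2) (φ : SmMap U W) (w : FormLoc W) :
    incl a (pullF φ w) = pullG φ (incl a w) := by
  have : (incl a).comp (pullF φ) = (pullG φ).comp (incl a) := by
    refine form_hom_ext (fun f => ?_) (fun i => ?_) <;> simp
  exact DFunLike.congr_fun this w

theorem EG_incl_self (a : Fin 2) (w : FormLoc U) : EG a (incl a w) = incl a (EF w) := by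
  refine (form_twist_even isEvenDer_EF (isEvenDer_EG a) (fun f => ?_) (fun i => ?_) w).symm
  · simp [EF_ffn, EG_fn]
  · simp [EF_dx, EG_xi]

theorem EG_incl_ne {a b : Fin 2} (h : b ≠ a) (w : FormLoc U) : EG b (incl a w) = 0 := by
  refine (form_twist_even (D := 0) ⟨by simp, by simp⟩ (isEvenDer_EG b) (h := incl a) (fun f => ?_)
    (fun i => ?_) w).symm.trans (map_zero _)
  · simp [EG_fn]
  · simp [EG_xi, h]

theorem proj_EG (a : Fin 2) (w : GormLoc U) : proj a (EG a w) = EF (proj a w) := by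
  refine gorm_twist_even (isEvenDer_EG a) isEvenDer_EF (fun f => ?_) (fun b i => ?_)
    (fun i => ?_) w
  · simp [EF_ffn, EG_fn]
  · by_cases h : b = a
    · subst h; simp [EF_dx, EG_xi]
    · simp [EG_xi, h, Ne.symm h]
  · simp [EG_yy]

theorem proj_pullG (a : Fin 2) (φ : SmMap U W) (w : GormLoc W) :
    proj a (pullG φ w) = pullF φ (proj a w) := by
  have : (proj a).comp (pullG φ) = (pullF φ).comp (proj a) := by
    refine gorm_hom_ext (fun f => ?_) (fun b i => ?_) (fun i => ?_)
    · simp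
    · by_cases h : b = a
      · subst h; simp
      · simp [h]
    · fin_cases a <;> simp [pullY]
  exact DFunLike.congr_fun this w

/-! #### Degrees of the operators -/

theorem EG_dG (c a : Fin 2) (w : GormLoc U) :
    EG c (dG a w) = dG a (EG c w) + ((if c = a then 1 else 0 : ℤ) : ℝ) • dG a w := by
  rw [← sub_eq_iff_eq_add']
  refine gorm_twist_odd (h := AlgHom.id ℝ (GormLoc U)) (fun _ => rfl)
    ((isEvenDer_EG c).comm (isOddDer_dG a)) ((isOddDer_dG a).smul _)
    (fun f => ?_) (fun b i => ?_) (fun i => ?_) w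
  · by_cases h : c = a
    · simp [EG_fn, dG_fn, EG_xi, (isEvenDer_EG _).1, h]
    · simp [EG_fn, dG_fn, EG_xi, (isEvenDer_EG _).1, h]
  · fin_cases c <;> fin_cases a <;> fin_cases b <;> simp [EG_xi, dG_xi, EG_yy, eps]
  · by_cases h : c = a <;> simp [dG_yy, EG_yy, h]

theorem EG_RG (c a : Fin 2) (w : GormLoc U) :
    EG c (RG a w) = RG a (EG c w) + ((if c = a then 0 else -1 : ℤ) : ℝ) • RG a w := by
  rw [← sub_eq_iff_eq_add']
  refine gorm_twist_odd (h := AlgHom.id ℝ (GormLoc U)) (fun _ => rfl)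
    ((isEvenDer_EG c).comm (isOddDer_RG a)) ((isOddDer_RG a).smul _)
    (fun f => ?_) (fun b i => ?_) (fun i => ?_) w
  · by_cases h : c = a <;> simp [EG_fn, RG_fn, h]
  · fin_cases c <;> fin_cases a <;> fin_cases b <;> simp [EG_xi, RG_xi]
  · simp only [AlgHom.id_apply, LinearMap.sub_apply, LinearMap.comp_apply, LinearMap.smul_apply,
      RG_yy, EG_yy, EG_xi]
    split_ifs <;> simp

theorem EF_dF (w : FormLoc U) : EF (dF w) = dF (EF w) + dF w := by
  rw [← sub_eq_iff_eq_add']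
  refine form_twist_odd (h := AlgHom.id ℝ (FormLoc U)) (fun _ => rfl)
    (isEvenDer_EF.comm isOddDer_dF) isOddDer_dF (fun f => ?_) (fun i => ?_) w
  · simp [EF_ffn, dF_ffn, EF_dx, isEvenDer_EF.1]
  · simp [dF_dx, EF_dx]

end LocalGorms

/-! ### Forms and gorms on a manifold -/

section Manifold

universe u v

/-- A parametrization in `M`: a smooth map from an open subset of some `ℝᵐ` to `M`.
Inverses of charts are particular cases. -/
structure Plot (n : ℕ) (M : Type u) [TopologicalSpace M]
    [ChartedSpace (EuclideanSpace ℝ (Fin n)) M] where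
  /-- The number of parameters. -/
  dim : ℕ
  /-- The domain. -/
  dom : Dom dim
  /-- The map. -/
  map : C^∞⟮𝓡 dim, dom; 𝓡 n, M⟯

variable (n : ℕ) (M : Type u) [TopologicalSpace M] [ChartedSpace (EuclideanSpace ℝ (Fin n)) M]

variable {n M} in
/-- Precomposition (change of parameters). -/
abbrev Plot.pre (P : Plot n M) {m : ℕ} {V : Dom m} (φ : SmMap V P.dom) : Plot n M :=
  ⟨m, V, P.map.comp φ⟩

variable {n M} in
/-- Postcomposition with a smooth map of manifolds. -/
abbrev Plot.post {n' : ℕ} {N : Type v} [TopologicalSpace N]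
    [ChartedSpace (EuclideanSpace ℝ (Fin n')) N] (f : C^∞⟮𝓡 n, M; 𝓡 n', N⟯) (P : Plot n M) :
    Plot n' N :=
  ⟨P.dim, P.dom, f.comp P.map⟩

/-- Families of forms, one for each parametrization. -/
abbrev FormFam : Type u := ∀ P : Plot n M, FormLoc P.dom

/-- Families of gorms, one for each parametrization. -/
abbrev GormFam : Type u := ∀ P : Plot n M, GormLoc P.dom

instance : Ring (FormFam n M) := inferInstance
instance : Semiring (FormFam n M) := inferInstance
instance : AddCommGroup (FormFam n M) := inferInstance
instance : AddCommMonoid (FormFam n M) := inferInstance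
instance : Algebra ℝ (FormFam n M) := inferInstance
instance : Module ℝ (FormFam n M) := inferInstance
instance : Ring (GormFam n M) := inferInstance
instance : Semiring (GormFam n M) := inferInstance
instance : AddCommGroup (GormFam n M) := inferInstance
instance : AddCommMonoid (GormFam n M) := inferInstance
instance : Algebra ℝ (GormFam n M) := inferInstance
instance : Module ℝ (GormFam n M) := inferInstance

/-- Differential forms of degree `k` on `M`: a form is given by its expressions in all
parametrizations, and these expressions are related by the pullback of forms. (For inverses of
charts this is the usual description of a form through its coordinate expressions and their
transformation law; the expressions in the other parametrizations are determined by these.) -/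
def formHom (k : ℤ) : Submodule ℝ (FormFam n M) where
  carrier := {w | (∀ (P : Plot n M) (m : ℕ) (V : Dom m) (φ : SmMap V P.dom),
    (w (P.pre φ) : FormLoc V) = pullF φ (w P)) ∧ ∀ P, EF (w P) = (k : ℝ) • w P}
  add_mem' {a b} ha hb := ⟨fun P m V φ => by simp [ha.1, hb.1], fun P => by simp [ha.2, hb.2]⟩
  zero_mem' := ⟨fun P m V φ => by simp, fun P => by simp⟩
  smul_mem' r a ha := ⟨fun P m V φ => by simp [ha.1], fun P => by simp [ha.2, smul_comm r]⟩

/-- Differential gorms of bidegree `(p 0, p 1)` on `M`: a gorm is given by its expressions in all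
parametrizations, and these expressions are related by the pullback of gorms. (For inverses of
charts these are the coordinate expressions of the gorm and their transformation law; the
expressions in the other parametrizations are determined by these.) -/
def gormHom (p : Fin 2 → ℤ) : Submodule ℝ (GormFam n M) where
  carrier := {w | (∀ (P : Plot n M) (m : ℕ) (V : Dom m) (φ : SmMap V P.dom),
    (w (P.pre φ) : GormLoc V) = pullG φ (w P)) ∧ ∀ a P, EG a (w P) = (p a : ℝ) • w P}
  add_mem' {a b} ha hb := ⟨fun P m V φ => by simp [ha.1, hb.1], fun a P => by simp [ha.2, hb.2]⟩
  zero_mem' := ⟨fun P m V φ => by simp, fun a P => by simp⟩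
  smul_mem' r a ha := ⟨fun P m V φ => by simp [ha.1], fun a P => by simp [ha.2, smul_comm r]⟩

theorem formHom_one : (1 : FormFam n M) ∈ formHom n M 0 :=
  ⟨fun P m V φ => by simp, fun P => by simp [isEvenDer_EF.map_one]⟩

theorem gormHom_one : (1 : GormFam n M) ∈ gormHom n M 0 :=
  ⟨fun P m V φ => by simp, fun a P => by simp [(isEvenDer_EG a).map_one]⟩

variable {n M}

theorem formHom_mul {k l : ℤ} {w z : FormFam n M} (hw : w ∈ formHom n M k)
    (hz : z ∈ formHom n M l) : w * z ∈ formHom n M (k + l) :=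
  ⟨fun P m V φ => by simp [hw.1, hz.1],
   fun P => by simp [isEvenDer_EF.1, hw.2, hz.2, add_smul]⟩

theorem gormHom_mul {p q : Fin 2 → ℤ} {w z : GormFam n M}
    (hw : w ∈ gormHom n M p) (hz : z ∈ gormHom n M q) : w * z ∈ gormHom n M (p + q) :=
  ⟨fun P m V φ => by simp [hw.1, hz.1],
   fun a P => by simp [(isEvenDer_EG a).1, hw.2, hz.2, add_smul]⟩

theorem mul_mem_iSup {A κ : Type*} [Ring A] [Algebra ℝ A] [Add κ] {S : κ → Submodule ℝ A}
    (h : ∀ k l a b, a ∈ S k → b ∈ S l → a * b ∈ S (k + l)) {a b : A} (ha : a ∈ ⨆ k, S k)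
    (hb : b ∈ ⨆ k, S k) : a * b ∈ ⨆ k, S k := by
  have hmul : (⨆ k, S k) * (⨆ k, S k) ≤ ⨆ k, S k := by
    rw [Submodule.iSup_mul]
    refine iSup_le fun k => ?_
    rw [Submodule.mul_iSup]
    refine iSup_le fun l => Submodule.mul_le.mpr fun x hx y hy => ?_
    exact Submodule.mem_iSup_of_mem (k + l) (h k l x y hx hy)
  exact hmul (Submodule.mul_mem_mul ha hb)

variable (n M)

/-- The algebra `Ω(M)` of differential forms on `M`, the direct sum of its homogeneous parts. -/
def Forms : Subalgebra ℝ (FormFam n M) :=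
  (⨆ k, formHom n M k).toSubalgebra (Submodule.mem_iSup_of_mem 0 (formHom_one n M))
    fun _ _ hx hy => mul_mem_iSup (S := formHom n M) (fun _ _ _ _ h h' => formHom_mul h h') hx hy

/-- The algebra `Ω_[2](M)` of differential gorms on `M`, the direct sum of its bihomogeneous
parts. -/
def Gorms : Subalgebra ℝ (GormFam n M) :=
  (⨆ p, gormHom n M p).toSubalgebra (Submodule.mem_iSup_of_mem 0 (gormHom_one n M))
    fun _ _ hx hy => mul_mem_iSup (S := gormHom n M) (fun _ _ _ _ h h' => gormHom_mul h h') hx hy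

instance : Ring (Forms n M) := inferInstance
instance : AddCommGroup (Forms n M) := inferInstance
instance : AddCommMonoid (Forms n M) := inferInstance
instance : Algebra ℝ (Forms n M) := inferInstance
instance : Module ℝ (Forms n M) := inferInstance
instance : Ring (Gorms n M) := inferInstance
instance : AddCommGroup (Gorms n M) := inferInstance
instance : AddCommMonoid (Gorms n M) := inferInstance
instance : Algebra ℝ (Gorms n M) := inferInstance
instance : Module ℝ (Gorms n M) := inferInstance

variable {n M}

theorem iSup_map_mem {A B κ : Type*} [AddCommGroup A] [Module ℝ A] [AddCommGroup B] [Module ℝ B]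
    {S : κ → Submodule ℝ A} {T : Submodule ℝ B} (L : A → B) (h0 : L 0 = 0)
    (hadd : ∀ x y, L (x + y) = L x + L y) (h : ∀ k, ∀ w ∈ S k, L w ∈ T)
    {w : A} (hw : w ∈ ⨆ k, S k) : L w ∈ T :=
  Submodule.iSup_induction S (motive := fun w => L w ∈ T) hw h (h0 ▸ T.zero_mem)
    fun x y hx hy => hadd x y ▸ T.add_mem hx hy

theorem dF_hom {k : ℤ} {w : FormFam n M} (hw : w ∈ formHom n M k) :
    (fun P => dF (w P) : FormFam n M) ∈ formHom n M (k + 1) :=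
  ⟨fun P m V φ => (congrArg dF (hw.1 P m V φ)).trans (pullF_dF φ _).symm,
   fun P => by rw [EF_dF, hw.2, map_smul, Int.cast_add, add_smul, Int.cast_one, one_smul]⟩

theorem dG_hom (a : Fin 2) {p : Fin 2 → ℤ} {w : GormFam n M} (hw : w ∈ gormHom n M p) :
    (fun P => dG a (w P) : GormFam n M) ∈ gormHom n M (fun c => p c + if c = a then 1 else 0) :=
  ⟨fun P m V φ => (congrArg (dG a) (hw.1 P m V φ)).trans (pullG_dG a φ _).symm,
   fun c P => by rw [EG_dG, hw.2, map_smul, Int.cast_add, add_smul]⟩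

theorem RG_hom (a : Fin 2) {p : Fin 2 → ℤ} {w : GormFam n M} (hw : w ∈ gormHom n M p) :
    (fun P => RG a (w P) : GormFam n M) ∈ gormHom n M (fun c => p c + if c = a then 0 else -1) :=
  ⟨fun P m V φ => (congrArg (RG a) (hw.1 P m V φ)).trans (pullG_RG a φ _).symm,
   fun c P => by rw [EG_RG, hw.2, map_smul, Int.cast_add, add_smul]⟩

theorem EG_hom (a : Fin 2) {p : Fin 2 → ℤ} {w : GormFam n M} (hw : w ∈ gormHom n M p) :
    (fun P => EG a (w P) : GormFam n M) ∈ gormHom n M p :=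
  ⟨fun P m V φ => (congrArg (EG a) (hw.1 P m V φ)).trans (pullG_EG a φ _).symm,
   fun c P => by
    change EG c (EG a (w P)) = (p c : ℝ) • EG a (w P)
    rw [hw.2 a, map_smul, hw.2, smul_comm]⟩

theorem incl_hom (a : Fin 2) {k : ℤ} {w : FormFam n M} (hw : w ∈ formHom n M k) :
    (fun P => incl a (w P) : GormFam n M) ∈ gormHom n M (Pi.single a k) :=
  ⟨fun P m V φ => (congrArg (incl a) (hw.1 P m V φ)).trans (incl_pullF a φ _),
   fun c P => by
    by_cases h : c = a
    · subst h; rw [EG_incl_self, hw.2, map_smul, Pi.single_eq_same]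
    · rw [EG_incl_ne h, Pi.single_eq_of_ne h, Int.cast_zero, zero_smul]⟩

theorem proj_hom (a : Fin 2) {p : Fin 2 → ℤ} {w : GormFam n M} (hw : w ∈ gormHom n M p) :
    (fun P => proj a (w P) : FormFam n M) ∈ formHom n M (p a) :=
  ⟨fun P m V φ => (congrArg (proj a) (hw.1 P m V φ)).trans (proj_pullG a φ _),
   fun P => by rw [← proj_EG, hw.2, map_smul]⟩

/-- The de Rham differential on `Ω(M)`, given by `d = dx^i ∂/∂x^i` in every parametrization. -/
def dForm : Forms n M →ₗ[ℝ] Forms n M where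
  toFun w := ⟨fun P => dF (w.1 P),
    iSup_map_mem (fun z P => dF (z P)) (funext fun _ => map_zero _)
      (fun _ _ => funext fun _ => map_add _ _ _)
      (fun _ _ hz => Submodule.mem_iSup_of_mem _ (dF_hom hz)) w.2⟩
  map_add' _ _ := Subtype.ext (funext fun _ => map_add _ _ _)
  map_smul' r w := Subtype.ext (funext fun P => (dF).map_smul r (w.1 P))

/-- The differentials `d_a` on `Ω_[2](M)`,
given by `d_a = ξ_a^i ∂/∂x^i + ε_{ab} y^i ∂/∂ξ_b^i` in every parametrization. -/
def dGorm (a : Fin 2) : Gorms n M →ₗ[ℝ] Gorms n M where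
  toFun w := ⟨fun P => dG a (w.1 P),
    iSup_map_mem (fun z P => dG a (z P)) (funext fun _ => map_zero _)
      (fun _ _ => funext fun _ => map_add _ _ _)
      (fun _ _ hz => Submodule.mem_iSup_of_mem _ (dG_hom a hz)) w.2⟩
  map_add' _ _ := Subtype.ext (funext fun _ => map_add _ _ _)
  map_smul' r w := Subtype.ext (funext fun P => (dG a).map_smul r (w.1 P))

/-- The operators `R_a` on `Ω_[2](M)`, given by `R_a = ξ_a^i ∂/∂y^i` in every parametrization. -/
def RGorm (a : Fin 2) : Gorms n M →ₗ[ℝ] Gorms n M where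
  toFun w := ⟨fun P => RG a (w.1 P),
    iSup_map_mem (fun z P => RG a (z P)) (funext fun _ => map_zero _)
      (fun _ _ => funext fun _ => map_add _ _ _)
      (fun _ _ hz => Submodule.mem_iSup_of_mem _ (RG_hom a hz)) w.2⟩
  map_add' _ _ := Subtype.ext (funext fun _ => map_add _ _ _)
  map_smul' r w := Subtype.ext (funext fun P => (RG a).map_smul r (w.1 P))

/-- The degree operators `E_a^a` on `Ω_[2](M)`,
given by `E_a^a = ξ_a^i ∂/∂ξ_a^i + y^i ∂/∂y^i` in every parametrization. -/
def EGorm (a : Fin 2) : Gorms n M →ₗ[ℝ] Gorms n M where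
  toFun w := ⟨fun P => EG a (w.1 P),
    iSup_map_mem (fun z P => EG a (z P)) (funext fun _ => map_zero _)
      (fun _ _ => funext fun _ => map_add _ _ _)
      (fun _ _ hz => Submodule.mem_iSup_of_mem _ (EG_hom a hz)) w.2⟩
  map_add' _ _ := Subtype.ext (funext fun _ => map_add _ _ _)
  map_smul' r w := Subtype.ext (funext fun P => (EG a).map_smul r (w.1 P))

/-- The algebra embedding `Ω(M) → Ω_[2](M)` given by `d ↦ d_a`
(that is, `f ↦ f`, `dx^i ↦ d_a x^i`). -/
def inclForm (a : Fin 2) : Forms n M →ₐ[ℝ] Gorms n M where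
  toFun w := ⟨fun P => incl a (w.1 P),
    iSup_map_mem (fun z P => incl a (z P)) (funext fun _ => map_zero _)
      (fun _ _ => funext fun _ => map_add _ _ _)
      (fun _ _ hz => Submodule.mem_iSup_of_mem _ (incl_hom a hz)) w.2⟩
  map_one' := Subtype.ext (funext fun _ => map_one _)
  map_mul' _ _ := Subtype.ext (funext fun _ => map_mul _ _ _)
  map_zero' := Subtype.ext (funext fun _ => map_zero _)
  map_add' _ _ := Subtype.ext (funext fun _ => map_add _ _ _)
  commutes' r := Subtype.ext (funext fun _ => (incl a).commutes r)

/-- The algebra projection `Ω_[2](M) → Ω(M)` given by `d_a ↦ d`, `d_b ↦ 0` for `b ≠ a`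
(that is, `f ↦ f`, `d_a x^i ↦ dx^i`, `d_b x^i ↦ 0`, `d₁d₂x^i ↦ 0`). -/
def projForm (a : Fin 2) : Gorms n M →ₐ[ℝ] Forms n M where
  toFun w := ⟨fun P => proj a (w.1 P),
    iSup_map_mem (fun z P => proj a (z P)) (funext fun _ => map_zero _)
      (fun _ _ => funext fun _ => map_add _ _ _)
      (fun _ _ hz => Submodule.mem_iSup_of_mem _ (proj_hom a hz)) w.2⟩
  map_one' := Subtype.ext (funext fun _ => map_one _)
  map_mul' _ _ := Subtype.ext (funext fun _ => map_mul _ _ _)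
  map_zero' := Subtype.ext (funext fun _ => map_zero _)
  map_add' _ _ := Subtype.ext (funext fun _ => map_add _ _ _)
  commutes' r := Subtype.ext (funext fun _ => (proj a).commutes r)

variable {n' : ℕ} {N : Type v} [TopologicalSpace N] [ChartedSpace (EuclideanSpace ℝ (Fin n')) N]

theorem formHom_post (f : C^∞⟮𝓡 n, M; 𝓡 n', N⟯) {k : ℤ} {w : FormFam n' N}
    (hw : w ∈ formHom n' N k) : (fun P => w (Plot.post f P) : FormFam n M) ∈ formHom n M k :=
  ⟨fun P => hw.1 (P.post f), fun P => hw.2 (P.post f)⟩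

theorem gormHom_post (f : C^∞⟮𝓡 n, M; 𝓡 n', N⟯) {p : Fin 2 → ℤ} {w : GormFam n' N}
    (hw : w ∈ gormHom n' N p) : (fun P => w (Plot.post f P) : GormFam n M) ∈ gormHom n M p :=
  ⟨fun P => hw.1 (P.post f), fun a P => hw.2 a (P.post f)⟩

/-- Pullback of forms by a smooth map `f : M → N`. -/
def pullForms (f : C^∞⟮𝓡 n, M; 𝓡 n', N⟯) : Forms n' N →ₐ[ℝ] Forms n M where
  toFun w := ⟨fun P => w.1 (P.post f),
    iSup_map_mem (fun z P => z (Plot.post f P)) rfl (fun _ _ => rfl)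
      (fun _ _ hz => Submodule.mem_iSup_of_mem _ (formHom_post f hz)) w.2⟩
  map_one' := rfl
  map_mul' _ _ := rfl
  map_zero' := rfl
  map_add' _ _ := rfl
  commutes' _ := rfl

/-- Pullback of gorms by a smooth map `f : M → N`. -/
def pullGorms (f : C^∞⟮𝓡 n, M; 𝓡 n', N⟯) : Gorms n' N →ₐ[ℝ] Gorms n M where
  toFun w := ⟨fun P => w.1 (P.post f),
    iSup_map_mem (fun z P => z (Plot.post f P)) rfl (fun _ _ => rfl)
      (fun _ _ hz => Submodule.mem_iSup_of_mem _ (gormHom_post f hz)) w.2⟩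
  map_one' := rfl
  map_mul' _ _ := rfl
  map_zero' := rfl
  map_add' _ _ := rfl
  commutes' _ := rfl

end Manifold

/-! ### Cohomology -/

section Cohomology

universe u v

variable {V W : Type*} [AddCommGroup V] [Module ℝ V] [AddCommGroup W] [Module ℝ W]

/-- The cohomology `ker d / im d` of a square-zero operator. -/
def Coh (d : V →ₗ[ℝ] V) : Type _ :=
  LinearMap.ker d ⧸ (LinearMap.range d).submoduleOf (LinearMap.ker d)

instance (d : V →ₗ[ℝ] V) : AddCommGroup (Coh d) :=
  inferInstanceAs (AddCommGroup (LinearMap.ker d ⧸ (LinearMap.range d).submoduleOf _))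

instance (d : V →ₗ[ℝ] V) : Module ℝ (Coh d) :=
  inferInstanceAs (Module ℝ (LinearMap.ker d ⧸ (LinearMap.range d).submoduleOf _))

/-- The map on cohomology induced by a linear map commuting with the differentials. -/
def Coh.map {d : V →ₗ[ℝ] V} {d' : W →ₗ[ℝ] W} (F : V →ₗ[ℝ] W) (h : ∀ v, F (d v) = d' (F v)) :
    Coh d →ₗ[ℝ] Coh d' :=
  Submodule.mapQ _ _
    (F.restrict (p := LinearMap.ker d) (q := LinearMap.ker d') fun v hv => by
      rw [LinearMap.mem_ker, ← h, LinearMap.mem_ker.mp hv, map_zero]) <| by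
    rintro ⟨_, hv⟩ ⟨z, rfl⟩
    exact ⟨F z, (h z).symm⟩

/-- `F` is a quasi-isomorphism: it commutes with the differentials and induces an isomorphism of
the cohomologies. -/
def IsQuasiIso (d : V →ₗ[ℝ] V) (d' : W →ₗ[ℝ] W) (F : V →ₗ[ℝ] W) : Prop :=
  ∃ h : ∀ v, F (d v) = d' (F v), Function.Bijective (Coh.map F h)

variable (n : ℕ) (M : Type u) [TopologicalSpace M] [ChartedSpace (EuclideanSpace ℝ (Fin n)) M]

/-- The de Rham cohomology of `M`. -/
abbrev HdR : Type _ := Coh (dForm : Forms n M →ₗ[ℝ] Forms n M)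

/-- The cohomology of `Ω_[2](M)` with respect to `d_a`. -/
abbrev HGorm (a : Fin 2) : Type _ := Coh (dGorm a : Gorms n M →ₗ[ℝ] Gorms n M)

/-- The map from de Rham cohomology to the cohomology of `(Ω_[2](M), d_a)` induced by the
embedding `d ↦ d_a`. -/
def compH (a : Fin 2) : HdR n M →ₗ[ℝ] HGorm n M a :=
  Coh.map (inclForm a).toLinearMap fun w => Subtype.ext (funext fun P => incl_dF a (w.1 P))

variable {n M}
variable {n' : ℕ} {N : Type v} [TopologicalSpace N] [ChartedSpace (EuclideanSpace ℝ (Fin n')) N]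

/-- Pullback in de Rham cohomology. -/
def pullHdR (f : C^∞⟮𝓡 n, M; 𝓡 n', N⟯) : HdR n' N →ₗ[ℝ] HdR n M :=
  Coh.map (pullForms f).toLinearMap fun _ => rfl

/-- Pullback in the cohomology of gorms with respect to `d_a`. -/
def pullHGorm (a : Fin 2) (f : C^∞⟮𝓡 n, M; 𝓡 n', N⟯) : HGorm n' N a →ₗ[ℝ] HGorm n M a :=
  Coh.map (pullGorms f).toLinearMap fun _ => rfl

end Cohomology

end Gorm

end

open Gorm

universe u v

/-! The whole theorem rests on one bracket. For `a ≠ b`, `[R_b, d_a] = ε_{ab} E_b^b`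
(`RG_dG_add_dG_RG`), where `E_b^b` is the degree in `d_b`. Read in one way, `R_b` is a contracting
homotopy for `d_a` in nonzero `d_b`-degree; read in the other way, `d_a` is one for `R_b`. The same
computation thus yields both quasi-isomorphisms, and with `a = 2`, `b = 1` the bracket is the last
claim itself.

What remains lives in `d_b`-degree zero. There neither `ξ_b` nor `y` can occur, so only the forms in
`d_a` are left, that is, the image of `incl a` (`incl_proj_of_EG_eq_zero`). Hence `incl a ∘ proj a`
is the projection onto degree zero along the components of nonzero `d_b`-degree. Since a gorm is a
finite sum of global bihomogeneous ones, `E_b^b` can be inverted on those components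
(`exists_EGorm_eq`), and on cocycles of either differential `incl a ∘ proj a` differs from the
identity by a coboundary.

Since `R_b` and `E_b^b` are global operators, no Poincaré lemma and no partition of unity enters.
Local identities between derivations are checked on the generators `f`, `ξ_a^i`, `y^i`; the global
ones follow parametrization by parametrization. Naturality holds already for representatives. -/

noncomputable section

namespace Gorm

/-! ### Brackets, inclusion and projection in coordinates -/

section Local

variable {m : ℕ} {U : Dom m}

/-- The bracket `[R_a, R_a] = 2 R_a²` of an odd derivation with itself is an even derivation, so it
vanishes as soon as it kills the generators; then divide by 2. -/
theorem RG_RG (a : Fin 2) (w : GormLoc U) : RG a (RG a w) = 0 := by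
  have h2 : (2 : ℝ) • RG a (RG a w) = 0 := by
    rw [two_smul]
    refine gorm_twist_even (h := AlgHom.id ℝ (GormLoc U)) ((isOddDer_RG a).bracket (isOddDer_RG a))
      isEvenDer_zero (fun f => ?_) (fun c i => ?_) (fun i => ?_) w
    · simp [RG_fn]
    · simp [RG_xi]
    · simp [RG_yy, RG_xi]
  exact (smul_eq_zero.mp h2).resolve_left two_ne_zero

/-- The bracket `[R_b, d_a] = ε_{ab} E_b^b` for `a ≠ b`. -/
theorem RG_dG_add_dG_RG {a b : Fin 2} (h : a ≠ b) (w : GormLoc U) :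
    RG b (dG a w) + dG a (RG b w) = eps a b • EG b w := by
  refine gorm_twist_even (h := AlgHom.id ℝ (GormLoc U)) ((isOddDer_RG b).bracket (isOddDer_dG a))
    ((isEvenDer_EG b).smul (eps a b)) (fun f => ?_) (fun c i => ?_) (fun i => ?_) w
  · simp [RG_fn, dG_fn, EG_fn, RG_xi, (isOddDer_RG b).1]
  -- Only here does `a ≠ b` matter: on `ξ_c` the bracket is `ε_{ac} ξ_b`, and it agrees with `ε_{ab}
  -- E_b^b ξ_c` because `c` is either `b` or `a`, with `ε_{aa} = 0`.
  · fin_cases a <;> fin_cases b <;> fin_cases c <;>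
      simp [RG_xi, dG_xi, EG_xi, RG_yy, eps] at h ⊢
  · simp [RG_yy, dG_yy, dG_xi, EG_yy]

theorem proj_incl (a : Fin 2) (w : FormLoc U) : proj a (incl a w) = w := by
  have : (proj a).comp (incl a) = AlgHom.id ℝ (FormLoc U) := by
    refine form_hom_ext (fun f => ?_) (fun i => ?_) <;> simp
  exact DFunLike.congr_fun this w

/-- Needed to compare odd derivations along `proj a`: their Leibniz rule involves the parity. -/
theorem proj_par (a : Fin 2) (w : GormLoc U) : proj a (par w) = par (proj a w) := by
  have : (proj a).comp par = (par : FormLoc U →ₐ[ℝ] FormLoc U).comp (proj a) := by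
    refine gorm_hom_ext (fun f => ?_) (fun b i => ?_) (fun i => ?_)
    · simp
    · by_cases h : b = a <;> simp [h]
    · simp
  exact DFunLike.congr_fun this w

/-- Every monomial of positive `d_b`-degree has a factor `ξ_b` or `y`, and `proj a` kills both.
Consequently `proj a` vanishes on eigenvectors of `E_b^b` with nonzero eigenvalue. -/
theorem proj_EG_ne {a b : Fin 2} (h : a ≠ b) (w : GormLoc U) : proj a (EG b w) = 0 := by
  refine gorm_twist_even (D' := 0) (isEvenDer_EG b) ⟨by simp, by simp⟩ (fun f => ?_)
    (fun c i => ?_) (fun i => ?_) w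
  · simp [EG_fn]
  · by_cases hc : b = c
    · subst hc; simp [EG_xi, h.symm]
    · simp [EG_xi, hc]
  · simp [EG_yy]

/-- The term of `d_a` without counterpart in `d` replaces `ξ_b` by a multiple of `y`, and both lie
in the kernel of `proj a`. So the left inverse of `incl a` is a chain map, which makes the
comparison map injective. -/
theorem proj_dG (a : Fin 2) (w : GormLoc U) : proj a (dG a w) = dF (proj a w) := by
  refine gorm_twist_odd (proj_par a) (isOddDer_dG a) isOddDer_dF (fun f => ?_)
    (fun c i => ?_) (fun i => ?_) w
  · simp [dG_fn, dF_ffn]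
  · by_cases hc : c = a <;> simp [dG_xi, hc, dF_dx]
  · simp [dG_yy]

/-- Whatever `R_b` produces carries a factor `ξ_b`, which `proj a` kills. This is why the target
complex has zero differential. -/
theorem proj_RG_ne {a b : Fin 2} (h : a ≠ b) (w : GormLoc U) : proj a (RG b w) = 0 := by
  refine gorm_twist_odd (D' := 0) (proj_par a) (isOddDer_RG b) ⟨by simp, by simp⟩ (fun f => ?_)
    (fun c i => ?_) (fun i => ?_) w
  · simp [RG_fn]
  · simp [RG_xi]
  · simp [RG_yy, h.symm]

/-- `R_b` differentiates only in `y`, which is absent from the image of `incl a`; the two indices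
may coincide. -/
theorem RG_incl (a b : Fin 2) (w : FormLoc U) : RG b (incl a w) = 0 := by
  refine (form_twist_odd (D := 0) (incl_par a) ⟨by simp, by simp⟩ (isOddDer_RG b) (fun f => ?_)
    (fun i => ?_) w).symm.trans (map_zero _)
  · simp [RG_fn]
  · simp [RG_xi]

/-! ### Decomposition by the degree in `d_b` -/

theorem EG_mul_of_eigen {b : Fin 2} {v w : GormLoc U} {r s : ℝ} (hv : EG b v = r • v)
    (hw : EG b w = s • w) : EG b (v * w) = (r + s) • (v * w) := by
  rw [(isEvenDer_EG b).1, hv, hw, smul_mul_assoc, mul_smul_comm, add_smul]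

/-- The eigenspaces of `E_b^b` for positive integral eigenvalues, together with the forms in the
other odd variables, which form the eigenspace of `0`. -/
def weight (a b : Fin 2) (k : ℕ) : Submodule ℝ (GormLoc U) :=
  if k = 0 then LinearMap.range (incl a : FormLoc U →ₐ[ℝ] GormLoc U).toLinearMap
  else Module.End.eigenspace (EG b) (k : ℝ)

theorem weight_le {a b : Fin 2} (h : a ≠ b) (k : ℕ) :
    (weight a b k : Submodule ℝ (GormLoc U)) ≤ Module.End.eigenspace (EG b) (k : ℝ) := by
  by_cases hk : k = 0
  · subst hk
    rintro _ hw
    rw [weight, if_pos rfl] at hw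
    obtain ⟨w, rfl⟩ := hw
    rw [Module.End.mem_eigenspace_iff]
    rw [Nat.cast_zero, zero_smul]
    exact EG_incl_ne h.symm w
  · rw [weight, if_neg hk]

/-- In weight zero both factors are forms and `incl a` is multiplicative; in positive weight the
Leibniz rule adds the eigenvalues. -/
theorem weight_mul {a b : Fin 2} (h : a ≠ b) (k l : ℕ) (v w : GormLoc U) (hv : v ∈ weight a b k)
    (hw : w ∈ weight a b l) : v * w ∈ weight a b (k + l) := by
  by_cases hkl : k + l = 0
  · obtain ⟨rfl, rfl⟩ := Nat.add_eq_zero_iff.mp hkl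
    rw [weight, if_pos rfl] at hv hw ⊢
    obtain ⟨v, rfl⟩ := hv
    obtain ⟨w, rfl⟩ := hw
    exact ⟨v * w, map_mul (incl a) v w⟩
  · have hv' := Module.End.mem_eigenspace_iff.mp (weight_le h k hv)
    have hw' := Module.End.mem_eigenspace_iff.mp (weight_le h l hw)
    rw [weight, if_neg hkl, Module.End.mem_eigenspace_iff, Nat.cast_add]
    exact EG_mul_of_eigen hv' hw'

/-- The span of the weight spaces is a subalgebra containing the generators: `f` and `ξ_a` have
weight 0, `ξ_b` and `y` weight 1. Since weight 0 was taken to be the forms rather than the kernel of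
`E_b^b`, this carries information about that kernel. -/
theorem mem_iSup_weight {a b : Fin 2} (h : a ≠ b) (w : GormLoc U) : w ∈ ⨆ k, weight a b k := by
  induction w using gorm_induction with
  | h_fn f =>
    exact Submodule.mem_iSup_of_mem 0 (by rw [weight, if_pos rfl]; exact ⟨ffn f, incl_ffn a f⟩)
  | h_xi c i =>
    by_cases hc : c = a
    · subst hc
      exact Submodule.mem_iSup_of_mem 0 (by rw [weight, if_pos rfl]; exact ⟨dx i, incl_dx c i⟩)
    · refine Submodule.mem_iSup_of_mem 1 ?_
      -- There are only two indices, and both `b` and `c` differ from `a`.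
      have hb : b = c := by omega
      rw [weight, if_neg one_ne_zero, Module.End.mem_eigenspace_iff, EG_xi, if_pos hb]
      simp
  | h_yy i =>
    refine Submodule.mem_iSup_of_mem 1 ?_
    rw [weight, if_neg one_ne_zero, Module.End.mem_eigenspace_iff, EG_yy]
    simp
  | h_add v w hv hw => exact add_mem hv hw
  | h_mul v w hv hw => exact mul_mem_iSup (weight_mul h) hv hw

/-- A gorm of degree zero in `d_b` is a form in `d_a`, for `a ≠ b`. -/
theorem incl_proj_of_EG_eq_zero {a b : Fin 2} (h : a ≠ b) {w : GormLoc U} (hw : EG b w = 0) :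
    incl a (proj a w) = w := by
  -- Every gorm is a form in `d_a` plus a combination of eigenvectors with nonzero eigenvalue.
  have hle : (⨆ k, weight a b k : Submodule ℝ (GormLoc U)) ≤
      LinearMap.range (incl a : FormLoc U →ₐ[ℝ] GormLoc U).toLinearMap ⊔
        ⨆ r ≠ (0 : ℝ), Module.End.eigenspace (EG b) r := by
    refine iSup_le fun k => ?_
    by_cases hk : k = 0
    · rw [weight, if_pos hk]
      exact le_sup_left
    · exact (weight_le h k).trans (le_sup_of_le_right
        (le_iSup₂_of_le (k : ℝ) (Nat.cast_ne_zero.mpr hk) le_rfl))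
  obtain ⟨_, ⟨f, rfl⟩, z, hz, rfl⟩ := Submodule.mem_sup.mp (hle (mem_iSup_weight h w))
  -- `E_b^b` kills both the gorm and its form part, hence also the remainder `z`. Independence of
  -- eigenspaces then forces `z = 0`.
  have hz0 : z ∈ Module.End.eigenspace (EG b) (0 : ℝ) := by
    rw [Module.End.mem_eigenspace_iff, zero_smul]
    rw [map_add] at hw
    exact (zero_add _).symm.trans ((congrArg (· + EG b z) (EG_incl_ne h.symm f)).symm.trans hw)
  have hz' : z = 0 := Submodule.disjoint_def.mp
    (Module.End.eigenspaces_iSupIndep (EG b : GormLoc U →ₗ[ℝ] GormLoc U) 0) z hz0 hz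
  subst hz'
  rw [add_zero]
  exact congrArg (incl a) (proj_incl a f)

end Local

/-! ### The same identities on a manifold -/

section Manifold

variable {n : ℕ} {M : Type u} [TopologicalSpace M] [ChartedSpace (EuclideanSpace ℝ (Fin n)) M]

theorem dForm_dForm (w : Forms n M) : dForm (dForm w) = 0 :=
  Subtype.ext (funext fun P => dF_dF (w.1 P))

theorem dGorm_dGorm (a : Fin 2) (w : Gorms n M) : dGorm a (dGorm a w) = 0 :=
  Subtype.ext (funext fun P => dG_dG a (w.1 P))

theorem RGorm_RGorm (a : Fin 2) (w : Gorms n M) : RGorm a (RGorm a w) = 0 :=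
  Subtype.ext (funext fun P => RG_RG a (w.1 P))

theorem RGorm_dGorm_add_dGorm_RGorm {a b : Fin 2} (h : a ≠ b) (w : Gorms n M) :
    RGorm b (dGorm a w) + dGorm a (RGorm b w) = eps a b • EGorm b w :=
  Subtype.ext (funext fun P => RG_dG_add_dG_RG h (w.1 P))

/-- `d_a` raises only the `d_a`-degree. -/
theorem EGorm_dGorm_ne {a b : Fin 2} (h : a ≠ b) (w : Gorms n M) :
    EGorm b (dGorm a w) = dGorm a (EGorm b w) :=
  Subtype.ext (funext fun P => (EG_dG b a (w.1 P)).trans (by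
    rw [if_neg h.symm, Int.cast_zero, zero_smul, add_zero]; rfl))

/-- `R_a` trades `y`, of bidegree `(1,1)`, for `ξ_a`: the degree in `d_a` is kept and only the other
one drops. -/
theorem EGorm_RGorm_self (a : Fin 2) (w : Gorms n M) :
    EGorm a (RGorm a w) = RGorm a (EGorm a w) :=
  Subtype.ext (funext fun P => (EG_RG a a (w.1 P)).trans (by
    rw [if_pos rfl, Int.cast_zero, zero_smul, add_zero]; rfl))

theorem inclForm_dForm (a : Fin 2) (w : Forms n M) :
    inclForm a (dForm w) = dGorm a (inclForm a w) :=
  Subtype.ext (funext fun P => incl_dF a (w.1 P))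

theorem projForm_dGorm (a : Fin 2) (w : Gorms n M) :
    projForm a (dGorm a w) = dForm (projForm a w) :=
  Subtype.ext (funext fun P => proj_dG a (w.1 P))

theorem projForm_inclForm (a : Fin 2) (w : Forms n M) : projForm a (inclForm a w) = w :=
  Subtype.ext (funext fun P => proj_incl a (w.1 P))

theorem projForm_RGorm_ne {a b : Fin 2} (h : a ≠ b) (w : Gorms n M) :
    projForm a (RGorm b w) = 0 :=
  Subtype.ext (funext fun P => proj_RG_ne h (w.1 P))

theorem RGorm_inclForm (a b : Fin 2) (w : Forms n M) : RGorm b (inclForm a w) = 0 :=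
  Subtype.ext (funext fun P => RG_incl a b (w.1 P))

/-! ### Inverting the degree, and the homotopies -/

theorem inclForm_projForm_of_EGorm_eq_zero {a b : Fin 2} (h : a ≠ b) {w : Gorms n M}
    (hw : EGorm b w = 0) : inclForm a (projForm a w) = w :=
  Subtype.ext (funext fun P =>
    incl_proj_of_EG_eq_zero h (congrFun (congrArg Subtype.val hw) P))

/-- Away from the forms in `d_a`, the degree in `d_b` is invertible. -/
theorem exists_EGorm_eq {a b : Fin 2} (h : a ≠ b) (w : Gorms n M) :
    ∃ u, EGorm b u = w - inclForm a (projForm a w) := by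
  obtain ⟨w, hw⟩ := w
  have key : ∃ u : Gorms n M, ∀ P, EG b (u.1 P) = w P - incl a (proj a (w P)) := by
    -- For a bihomogeneous `w`, either its `d_b`-degree is zero and `w` is already a form in `d_a`,
    -- or one divides by that degree and `proj a` kills `w`. Only nonvanishing of the degree is
    -- needed, not its sign.
    refine Submodule.iSup_induction (gormHom n M)
      (motive := fun w => ∃ u : Gorms n M, ∀ P, EG b (u.1 P) = w P - incl a (proj a (w P)))
      hw (fun p w hw => ?_) ⟨0, fun P => ?_⟩ ?_
    · by_cases hp : p b = 0
      · refine ⟨0, fun P => ?_⟩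
        have h0 : EG b (w P) = 0 := by rw [hw.2, hp, Int.cast_zero, zero_smul]
        rw [incl_proj_of_EG_eq_zero h h0, sub_self]
        exact map_zero _
      · have hp' : (p b : ℝ) ≠ 0 := Int.cast_ne_zero.mpr hp
        refine ⟨⟨(p b : ℝ)⁻¹ • w, Submodule.mem_iSup_of_mem p (Submodule.smul_mem _ _ hw)⟩,
          fun P => ?_⟩
        have h1 : w P = EG b ((p b : ℝ)⁻¹ • w P) := by
          rw [map_smul, hw.2, smul_smul, inv_mul_cancel₀ hp', one_smul]
        have h2 : proj a (w P) = 0 := by rw [h1, proj_EG_ne h]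
        rw [h2, map_zero, sub_zero]
        exact h1.symm
    · have h0 : EG b (0 : GormLoc P.dom) = 0 := map_zero _
      simp [h0]
    · rintro v v' ⟨u, hu⟩ ⟨u', hu'⟩
      refine ⟨u + u', fun P => (map_add (EG b) (u.1 P) (u'.1 P)).trans ?_⟩
      rw [hu, hu', Pi.add_apply, map_add, map_add]
      abel
  obtain ⟨u, hu⟩ := key
  exact ⟨u, Subtype.ext (funext hu)⟩

/-- On `d_a`-cocycles, `incl ∘ proj` is homotopic to the identity. -/
theorem sub_inclForm_projForm_mem_range_dGorm {a b : Fin 2} (h : a ≠ b) {w : Gorms n M}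
    (hw : dGorm a w = 0) : w - inclForm a (projForm a w) ∈ LinearMap.range (dGorm a) := by
  obtain ⟨u, hu⟩ := exists_EGorm_eq h w
  have he : eps a b ≠ 0 := by
    fin_cases a <;> fin_cases b <;> simp [eps] at h ⊢
  -- The solution `u` need not be a cocycle, but `d_a u` has `d_b`-degree zero, since `E_b^b d_a u =
  -- d_a(w - incl (proj w)) = 0`. So `d_a u` is a form in `d_a`, on which `R_b` vanishes, and one of
  -- the two terms of the bracket drops out.
  have h1 : EGorm b (dGorm a u) = 0 := by
    rw [EGorm_dGorm_ne h, hu, map_sub, hw, ← inclForm_dForm, ← projForm_dGorm, hw, map_zero,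
      map_zero, sub_zero]
  have h2 : RGorm b (dGorm a u) = 0 := by
    rw [← inclForm_projForm_of_EGorm_eq_zero h h1, RGorm_inclForm]
  have h3 := RGorm_dGorm_add_dGorm_RGorm h u
  rw [h2, zero_add, hu] at h3
  refine ⟨(eps a b)⁻¹ • RGorm b u, ?_⟩
  rw [map_smul, h3, smul_smul, inv_mul_cancel₀ he, one_smul]

/-- On `R_b`-cocycles, `incl ∘ proj` is homotopic to the identity. -/
theorem sub_inclForm_projForm_mem_range_RGorm {a b : Fin 2} (h : a ≠ b) {w : Gorms n M}
    (hw : RGorm b w = 0) : w - inclForm a (projForm a w) ∈ LinearMap.range (RGorm b) := by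
  obtain ⟨u, hu⟩ := exists_EGorm_eq h w
  have he : eps a b ≠ 0 := by
    fin_cases a <;> fin_cases b <;> simp [eps] at h ⊢
  -- Here the other term of the bracket drops out: `R_b u` has `d_b`-degree zero, so it is recovered
  -- from its projection, and `proj a ∘ R_b = 0`.
  have h1 : EGorm b (RGorm b u) = 0 := by
    rw [EGorm_RGorm_self, hu, map_sub, hw, RGorm_inclForm, sub_zero]
  have h2 : RGorm b u = 0 := by
    rw [← inclForm_projForm_of_EGorm_eq_zero h h1, projForm_RGorm_ne h, map_zero]
  have h3 := RGorm_dGorm_add_dGorm_RGorm h u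
  rw [h2, map_zero, add_zero, hu] at h3
  refine ⟨(eps a b)⁻¹ • dGorm a u, ?_⟩
  rw [map_smul, h3, smul_smul, inv_mul_cancel₀ he, one_smul]

end Manifold

/-! ### Passage to cohomology -/

section Cohomology

variable {V W : Type*} [AddCommGroup V] [Module ℝ V] [AddCommGroup W] [Module ℝ W]

/-- Restates bijectivity on quotients in terms of representatives, the form in which the homotopies
apply. -/
theorem Coh.map_bijective {d : V →ₗ[ℝ] V} {d' : W →ₗ[ℝ] W} (F : V →ₗ[ℝ] W)
    (h : ∀ v, F (d v) = d' (F v))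
    (inj : ∀ v, d v = 0 → F v ∈ LinearMap.range d' → v ∈ LinearMap.range d)
    (surj : ∀ w, d' w = 0 → ∃ v, d v = 0 ∧ F v - w ∈ LinearMap.range d') :
    Function.Bijective (Coh.map F h) := by
  constructor
  · refine (injective_iff_map_eq_zero _).mpr fun c hc => ?_
    obtain ⟨⟨v, hv⟩, rfl⟩ := Submodule.Quotient.mk_surjective _ c
    have hFv : d' (F v) = 0 := by rw [← h, LinearMap.mem_ker.mp hv, map_zero]
    have hc' : (Submodule.Quotient.mk ⟨F v, hFv⟩ :
        LinearMap.ker d' ⧸ (LinearMap.range d').submoduleOf (LinearMap.ker d')) = 0 := hc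
    have hc'' := (Submodule.Quotient.mk_eq_zero _).mp hc'
    exact (Submodule.Quotient.mk_eq_zero
      ((LinearMap.range d).submoduleOf (LinearMap.ker d))).mpr (inj v hv hc'')
  · intro c
    obtain ⟨⟨w, hw⟩, rfl⟩ := Submodule.Quotient.mk_surjective _ c
    obtain ⟨v, hv, hvw⟩ := surj w hw
    exact ⟨Submodule.Quotient.mk ⟨v, hv⟩, (Submodule.Quotient.eq
      ((LinearMap.range d').submoduleOf (LinearMap.ker d'))).mpr hvw⟩

variable (n : ℕ) (M : Type u) [TopologicalSpace M] [ChartedSpace (EuclideanSpace ℝ (Fin n)) M]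

/-- The inverse is induced by `proj a`: it is a chain map and a left inverse already on forms, and a
right inverse up to the homotopy built from `R_b`. -/
theorem compH_bijective (a : Fin 2) : Function.Bijective (compH n M a) := by
  obtain ⟨b, h⟩ : ∃ b : Fin 2, a ≠ b := (exists_ne a).imp fun _ => Ne.symm
  refine Coh.map_bijective _ _ ?_ fun w hw => ⟨projForm a w, ?_, ?_⟩
  · rintro v - ⟨z, hz⟩
    refine ⟨projForm a z, ?_⟩
    rw [← projForm_dGorm, hz]
    exact projForm_inclForm a v
  · rw [← projForm_dGorm, hw, map_zero]
  · rw [← neg_sub]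
    exact neg_mem (sub_inclForm_projForm_mem_range_dGorm h hw)

/-- Here `incl a` induces the inverse, its image consisting of `R_b`-cocycles; the homotopy built
from `d_a` gives injectivity. -/
theorem isQuasiIso_projForm {a b : Fin 2} (h : a ≠ b) :
    IsQuasiIso (RGorm b) 0 (projForm a : Gorms n M →ₐ[ℝ] Forms n M).toLinearMap := by
  refine ⟨fun w => projForm_RGorm_ne h w, Coh.map_bijective _ _ ?_
    fun w _ => ⟨inclForm a w, RGorm_inclForm a b w, ?_⟩⟩
  · rintro w hw ⟨z, hz⟩
    -- A coboundary for the zero differential is zero.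
    have hz' : projForm a w = 0 := hz.symm
    have := sub_inclForm_projForm_mem_range_RGorm h hw
    rwa [hz', map_zero, sub_zero] at this
  · exact ⟨0, (sub_eq_zero.mpr (projForm_inclForm a w)).symm⟩

variable {n M}
variable {n' : ℕ} {N : Type v} [TopologicalSpace N] [ChartedSpace (EuclideanSpace ℝ (Fin n')) N]

/-- Pullback along `f` only reindexes a family by composing parametrizations with `f`, while the
embedding acts on each member separately; on representatives the two sides are the same family. -/
theorem compH_pullHdR (a : Fin 2) (f : C^∞⟮𝓡 n, M; 𝓡 n', N⟯) (c : HdR n' N) :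
    compH n M a (pullHdR f c) = pullHGorm a f (compH n' N a c) := by
  obtain ⟨w, rfl⟩ := Submodule.Quotient.mk_surjective _ c
  rfl

end Cohomology

end Gorm

end

/-! ### The theorem -/

theorem mainTheorem3 (n : ℕ) (M : Type u) [TopologicalSpace M]
    [ChartedSpace (EuclideanSpace ℝ (Fin n)) M] [IsManifold (𝓡 n) ∞ M] :
    -- the differentials and `R_1` square to zero
    (∀ w : Forms n M, dForm (dForm w) = 0) ∧
    (∀ (a : Fin 2) (w : Gorms n M), dGorm a (dGorm a w) = 0) ∧
    (∀ w : Gorms n M, RGorm 0 (RGorm 0 w) = 0) ∧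
    -- the comparison map from de Rham cohomology is an isomorphism,
    (∀ a : Fin 2, Function.Bijective (compH n M a)) ∧
    -- compatible with the degrees,
    (∀ (a : Fin 2) (k : ℤ) (w : Forms n M), w.1 ∈ formHom n M k →
      (inclForm a w).1 ∈ gormHom n M (Pi.single a k)) ∧
    -- and natural in the manifold
    (∀ (a : Fin 2) (n' : ℕ) (N : Type v) [TopologicalSpace N]
      [ChartedSpace (EuclideanSpace ℝ (Fin n')) N] [IsManifold (𝓡 n') ∞ N]
      (f : C^∞⟮𝓡 n, M; 𝓡 n', N⟯) (c : HdR n' N),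
      compH n M a (pullHdR f c) = pullHGorm a f (compH n' N a c)) ∧
    -- `d_1 ↦ 0`, `d_2 ↦ d` is a quasi-isomorphism from `(Ω_[2](M), R_1)` to `(Ω(M), 0)`
    IsQuasiIso (RGorm 0) 0 (projForm 1 : Gorms n M →ₐ[ℝ] Forms n M).toLinearMap ∧
    -- `[R_1, d_2] = -E_1^1`
    (∀ w : Gorms n M, RGorm 0 (dGorm 1 w) + dGorm 1 (RGorm 0 w) = - EGorm 0 w) := by
  refine ⟨dForm_dForm, dGorm_dGorm, RGorm_RGorm 0, compH_bijective n M,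
    fun a k w hw => incl_hom a hw, ?_, isQuasiIso_projForm n M (by decide), fun w => ?_⟩
  · intro a n' N _ _ _ f c
    exact compH_pullHdR a f c
  -- The minus sign is `ε_{21} = -1`, the indices 1 and 2 being encoded as 0 and 1.
  · rw [RGorm_dGorm_add_dGorm_RGorm (by decide)]
    simp [eps]
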